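/- Let $1\le A\le S$ and $A\le Q$ be integers. Packets arrive according to an ergodic (irreducible) Markov chain $a[n]$ on $\{0,\dots,A\}$ with transition probabilities $\gamma_{a,a'}$, stationary law $\phi$ and mean $\alpha=\sum_a a\phi_a$; let $P:\{0,\dots,S\}\to\mathbb R$ be nondecreasing and convex with $P(0)=0$ ($P(s)$ is the power needed to send $s$ packets over the AWGN channel). The queue length $q[n]\in\{0,\dots,Q\}$ evolves as $q[n+1]=q[n]-s[n]+a[n+1]$, where the rate $s[n]\in\{0,\dots,S\}$ must satisfy $0\le q[n]-s[n]\le Q-A$ (call such a rate feasible at $q[n]$). A transmission policy $F=\{f_{q,a}^s\}$ gives, for every state $(q,a)\in\{0,\dots,Q\}\times\{0,\dots,A\}$, a probability distribution $f_{q,a}^{\,\cdot}$ on the feasible rates, from which $s[n]$ is drawn when $(q[n],a[n])=(q,a)$. Thus $F$ induces a Markov chain on the states $(q,a)$; it is a unichain if it has exactly one closed communicating class. Let $\mathcal G$ be the set of state-action frequencies, i.e. of all $x_{q,a}^s\ge 0$ with $\sum_{q,a,s}x_{q,a}^s=1$, $x_{q,a}^s=0$ if $s$ is not feasible at $q$,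 and $$\sum_{q,a,s}\gamma_{a,a'}\,x_{q,a}^s\,\mathbf 1_{\{s=q+a'-q'\}}=\sum_{s}x_{q',a'}^s\qquad\text{for all } q',a',$$ let $$\mathcal R=\Bigl\{\Bigl(\sum_{q,a,s}P(s)x_{q,a}^s,\ \tfrac1\alpha\sum_{q,a,s}q\,x_{q,a}^s\Bigr):x\in\mathcal G\Bigr\}$$ be the set of obtainable pairs (average power, average delay), and let the optimal tradeoff curve $\mathcal L$ consist of all $(P^*,D^*)\in\mathcal R$ that, for some bound $P_{\rm th}\ge P^*$, minimize $D$ over all $(P,D)\in\mathcal R$ with $P\le P_{\rm th}$. Then for every $(P^*,D^*)\in\mathcal L$ there is a transmission policy $F$ whose Markov chain is a unichain and which achieves $(P^*,D^*)$: under its steady-state distribution $\pi$, $$\sum_{q,a,s}P(s)\pi(q,a)f_{q,a}^s=P^*,\qquad \frac1\alpha\sum_{q,a}q\,\pi(q,a)=D^*,$$ and from every initial state $(q_0,a_0)$, $$\lim_{N\to\infty}\frac1N\,\mathbb E^F_{q_0,a_0}\sum_{n=1}^N P(s[n])=P^*,\qquad \lim_{N\to\infty}\frac1N\,\mathbb E^F_{q_0,a_0}\Bigl\{\frac1\alpha\sum_{n=1}^N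 q[n]\Bigr\}=D^*.$$ Hence the optimal tradeoff does not depend on the initial state: for every $(q_0,a_0)$, the curve defined in the same way from the set of pairs of long-term average power and delay (the limits above) that transmission policies obtain when started at $(q_0,a_0)$ is again $\mathcal L$. -/

import Mathlib

open Filter Topology

noncomputable section

/-- System states `(q, a)`: queue length `q ∈ {0,…,Q}` and number of arrivals `a ∈ {0,…,A}`. -/
abbrev LinkState (A Q : ℕ) : Type := Fin (Q + 1) × Fin (A + 1)

/-- `φ` is a stationary probability distribution of the (row-stochastic) transition matrix `M`. -/
def IsStationaryLaw {X : Type*} [Fintype X] (M : Matrix X X ℝ) (φ : X → ℝ) : Prop :=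
  (∀ x, 0 ≤ φ x) ∧ ∑ x, φ x = 1 ∧ ∀ y, ∑ x, φ x * M x y = φ y

/-- Expected number of arrivals per timeslot, for the stationary arrival law `φ`. -/
def meanArrival {A : ℕ} (φ : Fin (A + 1) → ℝ) : ℝ := ∑ a : Fin (A + 1), ((a : ℕ) : ℝ) * φ a

/-- The rate `s` is feasible at queue length `q`: `0 ≤ q - s ≤ Q - A`
(no underflow of the buffer, and no overflow whatever the next arrival is). -/
def FeasibleRate (A Q : ℕ) (q s : ℕ) : Prop := s ≤ q ∧ q + A ≤ s + Q

/-- A randomized transmission policy: `prob q a s` is the probability `f_{q,a}^s` of transmitting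
`s` packets when the queue length is `q` and the number of arrivals is `a`. -/
structure TransmissionPolicy (A Q S : ℕ) where
  prob : Fin (Q + 1) → Fin (A + 1) → Fin (S + 1) → ℝ
  nonneg : ∀ q a s, 0 ≤ prob q a s
  sum_eq_one : ∀ q a, ∑ s, prob q a s = 1
  eq_zero_of_infeasible : ∀ (q : Fin (Q + 1)) (a : Fin (A + 1)) (s : Fin (S + 1)),
    ¬ FeasibleRate A Q q s → prob q a s = 0

/-- `1` if the next queue length is `q'` when `s` packets leave a queue of length `q` and then `a'`
packets arrive (that is, `q' = q - s + a'`), and `0` otherwise. -/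
def queueStep (q s a' q' : ℕ) : ℝ := if q' + s = q + a' then 1 else 0

/-- The transition matrix of the Markov chain of states `(q, a)` under the policy `F`;
the entry in row `(q, a)` and column `(q', a')` is `Pr{(q, a) → (q', a')}`. -/
def TransmissionPolicy.transition {A Q S : ℕ} (γ : Matrix (Fin (A + 1)) (Fin (A + 1)) ℝ)
    (F : TransmissionPolicy A Q S) : Matrix (LinkState A Q) (LinkState A Q) ℝ :=
  fun x y => γ x.2 y.2 * ∑ s, F.prob x.1 x.2 s * queueStep x.1 s y.2 y.1

/-- `C` is a closed communicating class of the Markov chain with transition matrix `M`: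
it is nonempty, and the states reachable from any of its states are exactly those of `C`. -/
def IsClosedClass {X : Type*} [Fintype X] [DecidableEq X] (M : Matrix X X ℝ) (C : Set X) : Prop :=
  C.Nonempty ∧ ∀ x ∈ C, ∀ y, (∃ n : ℕ, 0 < (M ^ n) x y) ↔ y ∈ C

/-- The Markov chain induced by the policy is a unichain: it has exactly one closed
communicating class (transient states are allowed). -/
def TransmissionPolicy.IsUnichain {A Q S : ℕ} (γ : Matrix (Fin (A + 1)) (Fin (A + 1)) ℝ)
    (F : TransmissionPolicy A Q S) : Prop :=
  ∃! C : Set (LinkState A Q), IsClosedClass (F.transition γ) C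

/-- Expected power spent in one timeslot when the state has law `μ` and policy `F` is used. -/
def TransmissionPolicy.expectedPower {A Q S : ℕ} (P : Fin (S + 1) → ℝ)
    (F : TransmissionPolicy A Q S) (μ : LinkState A Q → ℝ) : ℝ :=
  ∑ q, ∑ a, ∑ s, P s * μ (q, a) * F.prob q a s

/-- Expected queue length when the state has law `μ`. -/
def expectedQueue {A Q : ℕ} (μ : LinkState A Q → ℝ) : ℝ :=
  ∑ q : Fin (Q + 1), ∑ a : Fin (A + 1), ((q : ℕ) : ℝ) * μ (q, a)

/-- The law of the state in timeslot `n` when policy `F` is used from the initial state `x₀`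
in timeslot `0`. -/
def TransmissionPolicy.stateLaw {A Q S : ℕ} (γ : Matrix (Fin (A + 1)) (Fin (A + 1)) ℝ)
    (F : TransmissionPolicy A Q S) (x₀ : LinkState A Q) (n : ℕ) : LinkState A Q → ℝ :=
  fun x => (F.transition γ ^ n) x₀ x

/-- From the initial state `x₀`, the long-term average power consumption and the long-term average
delay (average queue length divided by the mean arrival rate `α`, by Little's law) under the
policy `F` exist, and are `z.1` and `z.2` respectively. -/
def TransmissionPolicy.AttainsFrom {A Q S : ℕ} (γ : Matrix (Fin (A + 1)) (Fin (A + 1)) ℝ) (α : ℝ)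
    (P : Fin (S + 1) → ℝ) (F : TransmissionPolicy A Q S) (x₀ : LinkState A Q) (z : ℝ × ℝ) : Prop :=
  Tendsto (fun N : ℕ => (1 / (N : ℝ)) *
      ∑ n ∈ Finset.Icc 1 N, F.expectedPower P (F.stateLaw γ x₀ n)) atTop (𝓝 z.1) ∧
  Tendsto (fun N : ℕ => (1 / (N : ℝ)) *
      ((1 / α) * ∑ n ∈ Finset.Icc 1 N, expectedQueue (F.stateLaw γ x₀ n))) atTop (𝓝 z.2)

/-- The pairs (average power, average delay) obtained by the policies from the initial
state `x₀`. -/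
def pairsFrom {A Q S : ℕ} (γ : Matrix (Fin (A + 1)) (Fin (A + 1)) ℝ) (α : ℝ)
    (P : Fin (S + 1) → ℝ) (x₀ : LinkState A Q) : Set (ℝ × ℝ) :=
  {z | ∃ F : TransmissionPolicy A Q S, F.AttainsFrom γ α P x₀ z}

/-- The polyhedron `𝒢` of state-action frequencies `x_{q,a}^s`: balance equations, total mass one,
nonnegativity, and no mass on infeasible rates. -/
def stateActionFrequencies (A Q S : ℕ) (γ : Matrix (Fin (A + 1)) (Fin (A + 1)) ℝ) :
    Set (Fin (Q + 1) → Fin (A + 1) → Fin (S + 1) → ℝ) :=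
  {x | (∀ (q' : Fin (Q + 1)) (a' : Fin (A + 1)),
      ∑ q : Fin (Q + 1), ∑ a : Fin (A + 1), ∑ s : Fin (S + 1),
        γ a a' * x q a s * queueStep q s a' q' = ∑ s, x q' a' s) ∧
    ∑ q, ∑ a, ∑ s, x q a s = 1 ∧
    (∀ q a s, 0 ≤ x q a s) ∧
    ∀ (q : Fin (Q + 1)) (a : Fin (A + 1)) (s : Fin (S + 1)), ¬ FeasibleRate A Q q s → x q a s = 0}

/-- The set `ℛ` of obtainable pairs (average power, average delay), the image of `𝒢`. -/
def obtainablePairs {A S : ℕ} (Q : ℕ) (γ : Matrix (Fin (A + 1)) (Fin (A + 1)) ℝ) (α : ℝ)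
    (P : Fin (S + 1) → ℝ) : Set (ℝ × ℝ) :=
  {z | ∃ x ∈ stateActionFrequencies A Q S γ,
    z.1 = ∑ q, ∑ a, ∑ s, P s * x q a s ∧
    z.2 = (1 / α) * ∑ q : Fin (Q + 1), ∑ a : Fin (A + 1), ∑ s : Fin (S + 1), ((q : ℕ) : ℝ) * x q a s}

/-- The optimal tradeoff curve of a set of (power, delay) pairs: all the pairs that minimize the
delay subject to an upper bound `Pth` on the power, for some `Pth`. -/
def tradeoffCurve (R : Set (ℝ × ℝ)) : Set (ℝ × ℝ) :=
  {z | z ∈ R ∧ ∃ Pth : ℝ, z.1 ≤ Pth ∧ ∀ w ∈ R, w.1 ≤ Pth → z.2 ≤ w.2}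

end

/-! ### Finite Markov chains: closed classes, stationary laws, time averages. -/

section MarkovChain

variable {X : Type*} [Fintype X] [DecidableEq X] {M : Matrix X X ℝ}

/-! A point of the curve is realized by a state-action frequency `x`, a circulation of mass on
choices `(q, a, s)`. Normalizing `x` at each state gives a policy with the right stationary
averages; the difficulty is that its chain might have several closed classes. Among the frequencies
with the given power and mean queue, `x` is therefore taken with maximal support
(`exists_hasMaximalSupport`).

Two facts then force a unichain. By `exists_emptying`, every closed set of states that carries mass
contains a choice emptying the buffer: otherwise all its queue lengths could be lowered by one at
the same power. By `exists_swap`, if two used choices with the same arrivals cross, the longer queue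
being left with fewer packets, exchanging their leftovers keeps the balance and the mean queue.
Convexity of `P` keeps the power from rising, so maximality puts the exchanged choice in the
support. Hence, of two disjoint closed sets carrying mass, the one with the longer queue at some
common arrival stays strictly above the other for ever, and it can never empty
(`closedUnder_inter`). Outside the support the policy sends as much as possible, which leads into
the support, so some state is reachable from all (`exists_reachable_state`).

Such a state makes the stationary law unique, and compactness yields convergence of time averages
from every initial state (`tendsto_cesaroLaw`). For the curves at a fixed initial state, limits of
time averages are stationary averages, so all obtained pairs lie in `obtainablePairs`, while every
point of the optimal curve is attained. -/

theorem Matrix.pow_nonneg_of_mem_rowStochastic (hM : M ∈ Matrix.rowStochastic ℝ X) (n : ℕ)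
    (x y : X) : 0 ≤ (M ^ n) x y :=
  (pow_mem hM n).1 x y

theorem Matrix.exists_pow_pos_iff_reflTransGen (hM : ∀ x y, 0 ≤ M x y) (x y : X) :
    (∃ n : ℕ, 0 < (M ^ n) x y) ↔ Relation.ReflTransGen (fun u v => 0 < M u v) x y := by
  have hpow := Matrix.pow_apply_nonneg hM
  constructor
  · rintro ⟨n, hn⟩
    induction n generalizing y with
    | zero =>
      rw [pow_zero, Matrix.one_apply] at hn
      split_ifs at hn with h
      · exact h ▸ Relation.ReflTransGen.refl
      · exact absurd hn (lt_irrefl _)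
    | succ k ih =>
      rw [pow_succ, Matrix.mul_apply] at hn
      obtain ⟨w, -, hw⟩ := Finset.exists_lt_of_sum_lt
        (s := Finset.univ) (f := fun _ : X => (0 : ℝ)) (by simpa using hn)
      have h1 : 0 < (M ^ k) x w := by
        refine lt_of_le_of_ne (hpow k x w) fun h => ?_
        rw [← h, zero_mul] at hw
        exact lt_irrefl _ hw
      have h2 : 0 < M w y := by
        refine lt_of_le_of_ne (hM w y) fun h => ?_
        rw [← h, mul_zero] at hw
        exact lt_irrefl _ hw
      exact (ih w h1).tail h2
  · intro h
    induction h with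
    | refl => exact ⟨0, by simp⟩
    | @tail b c _ hbc ih =>
      obtain ⟨n, hn⟩ := ih
      refine ⟨n + 1, ?_⟩
      rw [pow_succ, Matrix.mul_apply]
      exact Finset.sum_pos' (fun w _ => mul_nonneg (hpow n x w) (hM w c))
        ⟨b, Finset.mem_univ b, mul_pos hn hbc⟩

/-- A state reachable from everywhere belongs to every closed class, which must then be the set of
states reachable from it. -/
theorem existsUnique_isClosedClass (hM : ∀ x y, 0 ≤ M x y) (v : X)
    (hv : ∀ x, ∃ n : ℕ, 0 < (M ^ n) x v) : ∃! C : Set X, IsClosedClass M C := by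
  simp only [IsClosedClass, Matrix.exists_pow_pos_iff_reflTransGen hM] at hv ⊢
  refine ⟨{y | Relation.ReflTransGen (fun u w => 0 < M u w) v y}, ⟨⟨v, .refl⟩, ?_⟩, ?_⟩
  · intro x hx y
    exact ⟨fun h => Relation.ReflTransGen.trans hx h, fun h => (hv x).trans h⟩
  · rintro C ⟨⟨x, hx⟩, hC⟩
    have hvC : v ∈ C := (hC x hx v).1 (hv x)
    ext y
    exact (hC v hvC y).symm

theorem sum_vecMul_of_mem_rowStochastic (hM : M ∈ Matrix.rowStochastic ℝ X) (μ : X → ℝ) :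
    ∑ y, ∑ x, μ x * M x y = ∑ x, μ x := by
  rw [Finset.sum_comm]
  refine Finset.sum_congr rfl fun x _ => ?_
  rw [← Finset.mul_sum, Matrix.sum_row_of_mem_rowStochastic hM, mul_one]

theorem sum_mul_pow_of_invariant {μ : X → ℝ} (hμ : ∀ y, ∑ x, μ x * M x y = μ y) (n : ℕ) (y : X) :
    ∑ x, μ x * (M ^ n) x y = μ y := by
  have h : Matrix.vecMul μ (M ^ n) = μ := by
    induction n with
    | zero => simp
    | succ k ih =>
      rw [pow_succ, ← Matrix.vecMul_vecMul, ih]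
      exact funext hμ
  exact congrFun h y

/-- The positive part of `δ` is dominated by its image under the chain, and the two have the same
total, so it is itself invariant. It vanishes at `v`, hence wherever `v` can be reached from. -/
theorem invariant_nonpos_of_reachable (hM : M ∈ Matrix.rowStochastic ℝ X) (v : X)
    (hv : ∀ x, ∃ n : ℕ, 0 < (M ^ n) x v) {δ : X → ℝ} (hδ : ∀ y, ∑ x, δ x * M x y = δ y)
    (hδv : δ v ≤ 0) (x : X) : δ x ≤ 0 := by
  set p : X → ℝ := fun x => max (δ x) 0 with hp
  have hle : ∀ y, p y ≤ ∑ x, p x * M x y := by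
    intro y
    refine max_le ?_ (Finset.sum_nonneg fun x _ => mul_nonneg (le_max_right _ _) (hM.1 x y))
    rw [← hδ y]
    exact Finset.sum_le_sum fun x _ => mul_le_mul_of_nonneg_right (le_max_left _ _) (hM.1 x y)
  have hinv : ∀ y, ∑ x, p x * M x y = p y := by
    intro y
    have := (Finset.sum_eq_sum_iff_of_le fun y (_ : y ∈ Finset.univ) => hle y).1
      (sum_vecMul_of_mem_rowStochastic hM p).symm y (Finset.mem_univ y)
    exact this.symm
  obtain ⟨n, hn⟩ := hv x
  have hpv : p v = 0 := max_eq_right hδv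
  have hsum := sum_mul_pow_of_invariant hinv n v
  rw [hpv, Finset.sum_eq_zero_iff_of_nonneg fun w _ => mul_nonneg (le_max_right _ _)
    (Matrix.pow_nonneg_of_mem_rowStochastic hM n w v)] at hsum
  have hx := (mul_eq_zero.1 (hsum x (Finset.mem_univ x))).resolve_right hn.ne'
  exact max_eq_right_iff.1 hx

/-- Two laws are comparable at the single state `v`; the comparison spreads to all states, and equal
total mass turns it into equality. -/
theorem IsStationaryLaw.eq_of_reachable (hM : M ∈ Matrix.rowStochastic ℝ X) (v : X)
    (hv : ∀ x, ∃ n : ℕ, 0 < (M ^ n) x v) {μ ν : X → ℝ} (hμ : IsStationaryLaw M μ)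
    (hν : IsStationaryLaw M ν) : μ = ν := by
  wlog h : μ v ≤ ν v generalizing μ ν
  · exact (this hν hμ (le_of_not_ge h)).symm
  have hle : ∀ x, μ x ≤ ν x := by
    intro x
    have := invariant_nonpos_of_reachable hM v hv (δ := fun x => μ x - ν x)
      (fun y => by simp only [sub_mul, Finset.sum_sub_distrib, hμ.2.2 y, hν.2.2 y])
      (sub_nonpos.2 h) x
    exact sub_nonpos.1 this
  funext x
  exact (Finset.sum_eq_sum_iff_of_le fun y (_ : y ∈ Finset.univ) => hle y).1
    (hμ.2.1.trans hν.2.1.symm) x (Finset.mem_univ x)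

theorem IsStationaryLaw.pos_of_isIrreducible (hM : M.IsIrreducible) {μ : X → ℝ}
    (hμ : IsStationaryLaw M μ) (y : X) : 0 < μ y := by
  have hpow := (Matrix.isIrreducible_iff_exists_pow_pos hM.nonneg).1 hM
  obtain ⟨x, hx⟩ : ∃ x, 0 < μ x := by
    by_contra! h
    have := Finset.sum_nonpos fun x (_ : x ∈ Finset.univ) => h x
    rw [hμ.2.1] at this
    norm_num at this
  obtain ⟨n, -, hn⟩ := hpow x y
  rw [← sum_mul_pow_of_invariant hμ.2.2 n y]
  exact Finset.sum_pos' (fun w _ => mul_nonneg (hμ.1 w)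
    (Matrix.pow_apply_nonneg hM.nonneg n w y)) ⟨x, Finset.mem_univ x, mul_pos hx hn⟩

/-- The law of the chain started at `x₀`, averaged over the timeslots `1, …, N`. -/
noncomputable def cesaroLaw (M : Matrix X X ℝ) (x₀ : X) (N : ℕ) : X → ℝ :=
  fun x => (1 / (N : ℝ)) * ∑ n ∈ Finset.Icc 1 N, (M ^ n) x₀ x

theorem cesaroLaw_nonneg (hM : M ∈ Matrix.rowStochastic ℝ X) (x₀ : X) (N : ℕ) (x : X) :
    0 ≤ cesaroLaw M x₀ N x :=
  mul_nonneg (by positivity)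
    (Finset.sum_nonneg fun n _ => Matrix.pow_nonneg_of_mem_rowStochastic hM n x₀ x)

theorem sum_cesaroLaw (hM : M ∈ Matrix.rowStochastic ℝ X) (x₀ : X) {N : ℕ} (hN : N ≠ 0) :
    ∑ x, cesaroLaw M x₀ N x = 1 := by
  simp only [cesaroLaw]
  rw [← Finset.mul_sum, Finset.sum_comm]
  simp only [Matrix.sum_row_of_mem_rowStochastic (pow_mem hM _)]
  have : (N : ℝ) ≠ 0 := by exact_mod_cast hN
  simp [this]

theorem cesaroLaw_le_one (hM : M ∈ Matrix.rowStochastic ℝ X) (x₀ : X) (N : ℕ) (x : X) :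
    cesaroLaw M x₀ N x ≤ 1 := by
  rcases eq_or_ne N 0 with rfl | hN
  · simp [cesaroLaw]
  · rw [← sum_cesaroLaw hM x₀ hN]
    exact Finset.single_le_sum (fun y _ => cesaroLaw_nonneg hM x₀ N y) (Finset.mem_univ x)

/-- One step of the chain shifts the averaging window by one timeslot, so only its two end terms
change; the factor `1 / N` makes this defect vanish in the limit. -/
theorem sum_cesaroLaw_mul (x₀ : X) (N : ℕ) (y : X) :
    ∑ x, cesaroLaw M x₀ N x * M x y =
      cesaroLaw M x₀ N y + (1 / (N : ℝ)) * ((M ^ (N + 1)) x₀ y - M x₀ y) := by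
  have h1 : ∑ x, cesaroLaw M x₀ N x * M x y =
      (1 / (N : ℝ)) * ∑ n ∈ Finset.Icc 1 N, (M ^ (n + 1)) x₀ y := by
    simp only [cesaroLaw, pow_succ M, Matrix.mul_apply (N := M), mul_assoc, Finset.sum_mul]
    rw [← Finset.mul_sum, Finset.sum_comm]
  have h2 : ∀ N : ℕ, ∑ n ∈ Finset.Icc 1 N, (M ^ (n + 1)) x₀ y =
      ∑ n ∈ Finset.Icc 1 N, (M ^ n) x₀ y + ((M ^ (N + 1)) x₀ y - M x₀ y) := by
    intro N
    induction N with
    | zero => simp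
    | succ k ih =>
      rw [Finset.sum_Icc_succ_top (by omega), Finset.sum_Icc_succ_top (by omega), ih]
      ring
  rw [h1, h2, cesaroLaw, mul_add]

theorem exists_subseq_tendsto_stationary (hM : M ∈ Matrix.rowStochastic ℝ X) (x₀ : X)
    {k : ℕ → ℕ} (hk : Tendsto k atTop atTop) :
    ∃ μ : X → ℝ, IsStationaryLaw M μ ∧ ∃ j : ℕ → ℕ, StrictMono j ∧
      Tendsto (fun i => cesaroLaw M x₀ (k (j i))) atTop (𝓝 μ) := by
  obtain ⟨μ, hμ, j, hj, hlim⟩ := (isCompact_Icc (a := (0 : X → ℝ)) (b := 1)).tendsto_subseq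
    (x := fun i => cesaroLaw M x₀ (k i))
    (fun i => ⟨fun x => cesaroLaw_nonneg hM x₀ _ x, fun x => cesaroLaw_le_one hM x₀ _ x⟩)
  have hkj : Tendsto (fun i => k (j i)) atTop atTop := hk.comp hj.tendsto_atTop
  have hpt : ∀ x, Tendsto (fun i => cesaroLaw M x₀ (k (j i)) x) atTop (𝓝 (μ x)) :=
    fun x => (tendsto_pi_nhds.1 hlim) x
  refine ⟨μ, ⟨hμ.1, ?_, fun y => ?_⟩, j, hj, hlim⟩
  · have h1 : Tendsto (fun i => ∑ x, cesaroLaw M x₀ (k (j i)) x) atTop (𝓝 (∑ x, μ x)) :=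
      tendsto_finsetSum _ fun x _ => hpt x
    refine tendsto_nhds_unique h1 (tendsto_const_nhds.congr' ?_)
    filter_upwards [hkj.eventually_ne_atTop 0] with i hi
    exact (sum_cesaroLaw hM x₀ hi).symm
  · have h1 : Tendsto (fun i => ∑ x, cesaroLaw M x₀ (k (j i)) x * M x y) atTop
        (𝓝 (∑ x, μ x * M x y)) :=
      tendsto_finsetSum _ fun x _ => (hpt x).mul_const _
    have h2 : Tendsto (fun N : ℕ => (1 / (N : ℝ)) * ((M ^ (N + 1)) x₀ y - M x₀ y)) atTop
        (𝓝 0) := by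
      refine squeeze_zero_norm (a := fun N : ℕ => 1 / (N : ℝ)) (fun N => ?_)
        tendsto_one_div_atTop_nhds_zero_nat
      rw [norm_mul, Real.norm_of_nonneg (by positivity : (0 : ℝ) ≤ 1 / (N : ℝ))]
      refine mul_le_of_le_one_right (by positivity) ?_
      rw [Real.norm_eq_abs, abs_le]
      have := Matrix.le_one_of_mem_rowStochastic (pow_mem hM (N + 1)) (i := x₀) (j := y)
      have := Matrix.pow_nonneg_of_mem_rowStochastic hM (N + 1) x₀ y
      have := Matrix.le_one_of_mem_rowStochastic hM (i := x₀) (j := y)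
      have := hM.1 x₀ y
      constructor <;> linarith
    refine tendsto_nhds_unique h1 ?_
    simp only [sum_cesaroLaw_mul]
    simpa using (hpt y).add (h2.comp hkj)

/-- Every subsequence has a further subsequence with a stationary limit, and only one stationary law
exists. Averaging makes aperiodicity unnecessary. -/
theorem tendsto_cesaroLaw (hM : M ∈ Matrix.rowStochastic ℝ X) (v : X)
    (hv : ∀ x, ∃ n : ℕ, 0 < (M ^ n) x v) {μ : X → ℝ} (hμ : IsStationaryLaw M μ) (x₀ : X) :
    Tendsto (cesaroLaw M x₀) atTop (𝓝 μ) := by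
  refine tendsto_of_subseq_tendsto fun k hk => ?_
  obtain ⟨ν, hν, j, -, hj⟩ := exists_subseq_tendsto_stationary hM x₀ hk
  exact ⟨j, hμ.eq_of_reachable hM v hv hν ▸ hj⟩

end MarkovChain

/-! ### State-action frequencies as flows on choices. -/

/-- A queue length, a number of arrivals, and a transmission rate used there. -/
abbrev RateChoice (A Q S : ℕ) : Type := Fin (Q + 1) × Fin (A + 1) × Fin (S + 1)

section Flow

variable {A Q S : ℕ} {γ : Matrix (Fin (A + 1)) (Fin (A + 1)) ℝ}

/-- The expected value of `h` at the state that follows the choice `t`. -/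
noncomputable def nextMean (γ : Matrix (Fin (A + 1)) (Fin (A + 1)) ℝ) (h : ℕ → Fin (A + 1) → ℝ)
    (t : RateChoice A Q S) : ℝ :=
  ∑ a' : Fin (A + 1), γ t.2.1 a' * h (t.1 - t.2.2 + a' : ℕ) a'

/-- Unnormalized state-action frequencies, with the balance equations tested against all
functions of the state. -/
structure IsFlow (γ : Matrix (Fin (A + 1)) (Fin (A + 1)) ℝ) (x : RateChoice A Q S → ℝ) :
    Prop where
  nonneg : ∀ t, 0 ≤ x t
  feasible : ∀ t : RateChoice A Q S, x t ≠ 0 → FeasibleRate A Q t.1 t.2.2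
  balance : ∀ h : ℕ → Fin (A + 1) → ℝ,
    ∑ t, x t * nextMean γ h t = ∑ t : RateChoice A Q S, x t * h t.1 t.2.1

/-- The set `W` of states cannot be left along choices in the support of `x`. -/
def ClosedUnder (γ : Matrix (Fin (A + 1)) (Fin (A + 1)) ℝ) (x : RateChoice A Q S → ℝ)
    (W : ℕ → Fin (A + 1) → Prop) : Prop :=
  ∀ (t : RateChoice A Q S) (a' : Fin (A + 1)), W t.1 t.2.1 → 0 < x t → 0 < γ t.2.1 a' →
    W (t.1 - t.2.2 + a' : ℕ) a'

theorem nextMean_congr {h h' : ℕ → Fin (A + 1) → ℝ} {t : RateChoice A Q S}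
    (hγ : ∀ a b, 0 ≤ γ a b)
    (H : ∀ a', 0 < γ t.2.1 a' → h (t.1 - t.2.2 + a' : ℕ) a' = h' (t.1 - t.2.2 + a' : ℕ) a') :
    nextMean γ h t = nextMean γ h' t := by
  refine Finset.sum_congr rfl fun a' _ => ?_
  rcases (hγ t.2.1 a').eq_or_lt with h0 | h0
  · rw [← h0, zero_mul, zero_mul]
  · rw [H a' h0]

theorem nextMean_const (hγ : γ ∈ Matrix.rowStochastic ℝ (Fin (A + 1))) (c : ℝ)
    (t : RateChoice A Q S) : nextMean γ (fun _ _ => c) t = c := by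
  rw [nextMean, ← Finset.sum_mul, Matrix.sum_row_of_mem_rowStochastic hγ, one_mul]

theorem exists_arrival_pos (hγ : γ ∈ Matrix.rowStochastic ℝ (Fin (A + 1))) (a : Fin (A + 1)) :
    ∃ b, 0 < γ a b := by
  by_contra! h
  have := Finset.sum_nonpos fun b (_ : b ∈ Finset.univ) => h b
  rw [Matrix.sum_row_of_mem_rowStochastic hγ] at this
  norm_num at this

theorem reflTransGen_of_isIrreducible (hγ : γ.IsIrreducible) (a b : Fin (A + 1)) :
    Relation.ReflTransGen (fun u v => 0 < γ u v) a b := by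
  obtain ⟨k, -, hk⟩ := (Matrix.isIrreducible_iff_exists_pow_pos hγ.nonneg).1 hγ a b
  exact (Matrix.exists_pow_pos_iff_reflTransGen hγ.nonneg a b).1 ⟨k, hk⟩

namespace IsFlow

variable {x y : RateChoice A Q S → ℝ}

/-- Testing the balance against the indicator of the successor state: mass flows in, so mass must
sit there. -/
theorem occupied_next (hγ : ∀ a b, 0 ≤ γ a b) (hx : IsFlow γ x) {t : RateChoice A Q S}
    {a' : Fin (A + 1)} (ht : 0 < x t) (ha : 0 < γ t.2.1 a') :
    ∃ u : RateChoice A Q S, (u.1 : ℕ) = t.1 - t.2.2 + a' ∧ u.2.1 = a' ∧ 0 < x u := by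
  classical
  by_contra! H
  have h := hx.balance fun n b => if n = t.1 - t.2.2 + a' ∧ b = a' then 1 else 0
  have hR : ∑ u : RateChoice A Q S,
      x u * (if (u.1 : ℕ) = t.1 - t.2.2 + a' ∧ u.2.1 = a' then (1 : ℝ) else 0) = 0 := by
    refine Finset.sum_eq_zero fun u _ => ?_
    split_ifs with hu
    · rw [le_antisymm (H u hu.1 hu.2) (hx.nonneg u), zero_mul]
    · rw [mul_zero]
  rw [hR] at h
  refine h.not_gt (Finset.sum_pos' (fun u _ => mul_nonneg (hx.nonneg u)
    (Finset.sum_nonneg fun b _ => mul_nonneg (hγ _ _) ?_)) ⟨t, Finset.mem_univ t, mul_pos ht ?_⟩)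
  · dsimp only; split_ifs <;> norm_num
  · refine Finset.sum_pos' (fun b _ => mul_nonneg (hγ _ _) ?_) ⟨a', Finset.mem_univ a', ?_⟩
    · dsimp only; split_ifs <;> norm_num
    · simpa using ha

theorem add_smul (hx : IsFlow γ x) (hy : IsFlow γ y) {c d : ℝ} (hc : 0 ≤ c) (hd : 0 ≤ d) :
    IsFlow γ fun t => c * x t + d * y t where
  nonneg t := add_nonneg (mul_nonneg hc (hx.nonneg t)) (mul_nonneg hd (hy.nonneg t))
  feasible t ht := by
    by_cases h : x t = 0
    · refine hy.feasible t fun h' => ht ?_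
      rw [h, h', mul_zero, mul_zero, add_zero]
    · exact hx.feasible t h
  balance h := by
    simp only [add_mul, Finset.sum_add_distrib, mul_assoc, ← Finset.mul_sum, hx.balance h,
      hy.balance h]

-- No mass leaves `W`, and the mass of `W` is preserved in one step, so none enters either: the flow
-- splits into its parts inside and outside `W`.
open Classical in
theorem restrict (hγ : γ ∈ Matrix.rowStochastic ℝ (Fin (A + 1))) (hx : IsFlow γ x)
    {W : ℕ → Fin (A + 1) → Prop} (hW : ClosedUnder γ x W) :
    IsFlow γ fun t => if W t.1 t.2.1 then x t else 0 := by
  have hin : ∀ t : RateChoice A Q S, W t.1 t.2.1 → 0 < x t →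
      ∀ h : ℕ → Fin (A + 1) → ℝ,
        nextMean γ (fun n b => if W n b then h n b else 0) t = nextMean γ h t :=
    fun t ht hxt h => nextMean_congr hγ.1 fun a' ha' => if_pos (hW t a' ht hxt ha')
  have hind : ∀ t : RateChoice A Q S, 0 ≤ nextMean γ (fun n b => if W n b then 1 else 0) t :=
    fun t => Finset.sum_nonneg fun b _ => mul_nonneg (hγ.1 _ _) (by dsimp only; split_ifs <;> norm_num)
  have hle : ∀ t : RateChoice A Q S, x t * (if W t.1 t.2.1 then 1 else 0) ≤
      x t * nextMean γ (fun n b => if W n b then 1 else 0) t := by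
    intro t
    rcases (hx.nonneg t).eq_or_lt with h0 | h0
    · rw [← h0, zero_mul, zero_mul]
    · refine mul_le_mul_of_nonneg_left ?_ h0.le
      split_ifs with ht
      · rw [hin t ht h0, nextMean_const hγ]
      · exact hind t
  have hout : ∀ t : RateChoice A Q S, ¬ W t.1 t.2.1 → 0 < x t → ∀ a', 0 < γ t.2.1 a' →
      ¬ W (t.1 - t.2.2 + a' : ℕ) a' := by
    intro t ht hxt a' ha' hWa
    have h1 := (Finset.sum_eq_sum_iff_of_le fun t (_ : t ∈ Finset.univ) => hle t).1
      (hx.balance fun n b => if W n b then 1 else 0).symm t (Finset.mem_univ t)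
    rw [if_neg ht, mul_zero, eq_comm, mul_eq_zero, or_iff_right hxt.ne'] at h1
    have h2 := (Finset.sum_eq_zero_iff_of_nonneg fun b _ => mul_nonneg (hγ.1 _ _)
      (by dsimp only; split_ifs <;> norm_num)).1 h1 a' (Finset.mem_univ a')
    dsimp only at h2
    rw [if_pos hWa, mul_one] at h2
    exact ha'.ne' h2
  refine ⟨fun t => ?_, fun t ht => ?_, fun h => ?_⟩
  · split_ifs
    exacts [hx.nonneg t, le_rfl]
  · split_ifs at ht
    · exact hx.feasible t ht
    · exact absurd rfl ht
  · have hb := hx.balance fun n b => if W n b then h n b else 0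
    refine Eq.trans (Finset.sum_congr rfl fun t _ => ?_) (hb.trans
      (Finset.sum_congr rfl fun t _ => ?_))
    · rcases (hx.nonneg t).eq_or_lt with h0 | h0
      · simp [← h0]
      split_ifs with ht
      · rw [hin t ht h0]
      · have h1 : nextMean γ (fun n b => if W n b then h n b else 0) t = 0 := by
          exact (nextMean_congr hγ.1 fun a' ha' => if_neg (hout t ht h0 a' ha')).trans
            (nextMean_const hγ 0 t)
        rw [h1, mul_zero, zero_mul]
    · split_ifs <;> simp

theorem exists_pos_of_closedUnder (hγ : ∀ a b, 0 ≤ γ a b) (hx : IsFlow γ x)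
    {W : ℕ → Fin (A + 1) → Prop} (hW : ClosedUnder γ x W) {t : RateChoice A Q S}
    (ht : W t.1 t.2.1) (hxt : 0 < x t) {b : Fin (A + 1)}
    (hb : Relation.ReflTransGen (fun u v => 0 < γ u v) t.2.1 b) :
    ∃ u : RateChoice A Q S, W u.1 u.2.1 ∧ 0 < x u ∧ u.2.1 = b := by
  induction hb with
  | refl => exact ⟨t, ht, hxt, rfl⟩
  | @tail c d _ hcd ih =>
    obtain ⟨u, hu, hxu, rfl⟩ := ih
    obtain ⟨v, hv1, hv2, hxv⟩ := hx.occupied_next hγ hxu hcd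
    refine ⟨v, ?_, hxv, hv2⟩
    rw [hv1, hv2]
    exact hW u d hu hxu hcd

end IsFlow

/-- The image of the weights `x` under the map `g`. -/
def pushWeights {T : Type*} [Fintype T] [DecidableEq T] (g : T → T) (x : T → ℝ) : T → ℝ :=
  fun t => ∑ u, if g u = t then x u else 0

theorem sum_pushWeights_mul {T : Type*} [Fintype T] [DecidableEq T] (g : T → T) (x f : T → ℝ) :
    ∑ t, pushWeights g x t * f t = ∑ t, x t * f (g t) := by
  simp only [pushWeights, Finset.sum_mul, ite_mul, zero_mul]
  rw [Finset.sum_comm]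
  simp

/-- Competitors to an optimal flow are built by altering each choice through a map `g`; the balance
can then be checked on the original weights. -/
theorem IsFlow.pushWeights {x : RateChoice A Q S → ℝ} (hx : ∀ t, 0 ≤ x t)
    (g : RateChoice A Q S → RateChoice A Q S)
    (hg : ∀ t, x t ≠ 0 → FeasibleRate A Q (g t).1 (g t).2.2)
    (hb : ∀ h : ℕ → Fin (A + 1) → ℝ, ∑ t, x t * nextMean γ h (g t) =
      ∑ t, x t * h (g t).1 (g t).2.1) : IsFlow γ (pushWeights g x) where
  nonneg t := Finset.sum_nonneg fun u _ => by split_ifs; exacts [hx u, le_rfl]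
  feasible t ht := by
    obtain ⟨u, -, hu⟩ := Finset.exists_ne_zero_of_sum_ne_zero ht
    obtain ⟨rfl, hxu⟩ := ite_ne_right_iff.1 hu
    exact hg u hxu
  balance h := by
    rw [sum_pushWeights_mul, hb, sum_pushWeights_mul g x fun t => h t.1 t.2.1]

/-! ### Consequences of optimality. -/

/-- Normalized state-action frequencies of minimal mean queue length among those of power at most
`c`. -/
structure IsOptimalFlow (γ : Matrix (Fin (A + 1)) (Fin (A + 1)) ℝ) (P : Fin (S + 1) → ℝ) (c : ℝ)
    (x : RateChoice A Q S → ℝ) : Prop extends IsFlow γ x where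
  mass : ∑ t, x t = 1
  power_le : ∑ t, x t * P t.2.2 ≤ c
  queue_le : ∀ y : RateChoice A Q S → ℝ, IsFlow γ y → ∑ t, y t = 1 → ∑ t, y t * P t.2.2 ≤ c →
    ∑ t, x t * ((t.1 : ℕ) : ℝ) ≤ ∑ t, y t * ((t.1 : ℕ) : ℝ)

namespace IsOptimalFlow

variable {P : Fin (S + 1) → ℝ} {c : ℝ} {x : RateChoice A Q S → ℝ}

/-- If no used choice in `W` emptied the buffer, one packet would lie idle at the bottom of the
queue throughout `W`. Removing it keeps the rates and the power and shortens the mean queue. -/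
theorem exists_emptying (hγ : γ ∈ Matrix.rowStochastic ℝ (Fin (A + 1)))
    (hx : IsOptimalFlow γ P c x) {W : ℕ → Fin (A + 1) → Prop} (hW : ClosedUnder γ x W)
    {t₀ : RateChoice A Q S} (ht₀ : W t₀.1 t₀.2.1) (hxt₀ : 0 < x t₀) :
    ∃ t : RateChoice A Q S, W t.1 t.2.1 ∧ 0 < x t ∧ (t.2.2 : ℕ) = t.1 := by
  classical
  by_contra! H
  have hlt : ∀ t : RateChoice A Q S, W t.1 t.2.1 → 0 < x t → (t.2.2 : ℕ) < t.1 :=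
    fun t ht hxt => lt_of_le_of_ne (hx.feasible t hxt.ne').1 (H t ht hxt)
  let g : RateChoice A Q S → RateChoice A Q S := fun t =>
    if W t.1 t.2.1 then (⟨t.1 - 1, by omega⟩, t.2) else t
  have hgW : ∀ t : RateChoice A Q S, W t.1 t.2.1 → g t = (⟨t.1 - 1, by omega⟩, t.2) :=
    fun t ht => if_pos ht
  have hgN : ∀ t : RateChoice A Q S, ¬ W t.1 t.2.1 → g t = t := fun t ht => if_neg ht
  have hg2 : ∀ t, (g t).2 = t.2 := by
    intro t
    by_cases ht : W t.1 t.2.1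
    · rw [hgW t ht]
    · rw [hgN t ht]
  have hflow : IsFlow γ (_root_.pushWeights g x) := by
    refine IsFlow.pushWeights hx.nonneg g (fun t hxt => ?_) fun h => ?_
    · have hf := hx.feasible t hxt
      by_cases ht : W t.1 t.2.1
      · have := hlt t ht (lt_of_le_of_ne (hx.nonneg t) hxt.symm)
        rw [hgW t ht]
        exact ⟨by dsimp only; omega, by have := hf.2; dsimp only; omega⟩
      · rwa [hgN t ht]
    -- The new balance is that of `x`, plus that of the part of `x` in `W` tested on the shifted
    -- `h`, minus that of the same part tested on `h`. As `s < q` there, truncated subtraction does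
    -- no harm.
    · have hr := hx.restrict hγ hW
      have h1 := hr.balance fun n b => h (n - 1) b
      have h2 := hr.balance h
      have h3 := hx.balance h
      have e1 : ∀ t, x t * nextMean γ h (g t) =
          x t * nextMean γ h t + (if W t.1 t.2.1 then x t else 0) *
            nextMean γ (fun n b => h (n - 1) b) t -
            (if W t.1 t.2.1 then x t else 0) * nextMean γ h t := by
        intro t
        by_cases ht : W t.1 t.2.1
        · rcases (hx.nonneg t).eq_or_lt with h0 | h0
          · simp [← h0]
          · have := hlt t ht h0
            have e : nextMean γ h (g t) = nextMean γ (fun n b => h (n - 1) b) t := by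
              rw [hgW t ht]
              refine Finset.sum_congr rfl fun a' _ => ?_
              dsimp only
              congr 2
              omega
            rw [if_pos ht, e]
            ring
        · rw [hgN t ht, if_neg ht]
          ring
      have e2 : ∀ t, x t * h (g t).1 (g t).2.1 =
          x t * h t.1 t.2.1 + (if W t.1 t.2.1 then x t else 0) * h (t.1 - 1) t.2.1 -
            (if W t.1 t.2.1 then x t else 0) * h t.1 t.2.1 := by
        intro t
        by_cases ht : W t.1 t.2.1
        · rw [hgW t ht, if_pos ht]
          ring
        · rw [hgN t ht, if_neg ht]
          ring
      simp only [e1, e2, Finset.sum_add_distrib, Finset.sum_sub_distrib]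
      rw [h1, h2, h3]
  have hm : ∑ t, _root_.pushWeights g x t = 1 := by
    simpa [hx.mass] using sum_pushWeights_mul g x fun _ => 1
  have hp : ∑ t, _root_.pushWeights g x t * P t.2.2 ≤ c := by
    rw [sum_pushWeights_mul g x fun t => P t.2.2]
    simpa only [hg2] using hx.power_le
  have hq := hx.queue_le _ hflow hm hp
  rw [sum_pushWeights_mul g x fun t => ((t.1 : ℕ) : ℝ)] at hq
  refine hq.not_gt (Finset.sum_lt_sum (fun t _ => mul_le_mul_of_nonneg_left ?_ (hx.nonneg t))
    ⟨t₀, Finset.mem_univ t₀, mul_lt_mul_of_pos_left ?_ hxt₀⟩)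
  · by_cases ht : W t.1 t.2.1
    · rw [hgW t ht]
      exact_mod_cast Nat.sub_le _ _
    · rw [hgN t ht]
  · have := hlt t₀ ht₀ hxt₀
    rw [hgW t₀ ht₀]
    dsimp only
    exact_mod_cast (by omega : (t₀.1 : ℕ) - 1 < t₀.1)

/-- Some state-action frequencies have a smaller mean queue length, unless the buffer is emptied in
every timeslot. -/
theorem _root_.IsFlow.exists_queue_lt (hγ : γ ∈ Matrix.rowStochastic ℝ (Fin (A + 1)))
    (hAS : A ≤ S) (hAQ : A ≤ Q) (hx : IsFlow γ x) {t₀ : RateChoice A Q S} (hxt₀ : 0 < x t₀)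
    (ht₀ : (t₀.2.2 : ℕ) < t₀.1) :
    ∃ y : RateChoice A Q S → ℝ, IsFlow γ y ∧ ∑ t, y t = ∑ t, x t ∧
      ∑ t, y t * ((t.1 : ℕ) : ℝ) < ∑ t, x t * ((t.1 : ℕ) : ℝ) := by
  classical
  -- The competitor sends every packet at once: the queue consists of the last arrivals and is
  -- emptied.
  let g : RateChoice A Q S → RateChoice A Q S := fun t =>
    (⟨t.2.1, by omega⟩, t.2.1, ⟨t.2.1, by omega⟩)
  refine ⟨_root_.pushWeights g x, IsFlow.pushWeights hx.nonneg g (fun t _ => ⟨le_rfl, ?_⟩)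
    fun h => ?_, ?_, ?_⟩
  · dsimp only [g]
    omega
  · have := hx.balance fun _ b => h b b
    simpa [nextMean, g] using this
  · simpa using sum_pushWeights_mul g x fun _ => 1
  · rw [sum_pushWeights_mul g x fun t => ((t.1 : ℕ) : ℝ)]
    -- Testing with the queue length and with the arrivals shows that the mean rate equals the mean
    -- number of arrivals, which is the mean queue of the competitor.
    have h1 := hx.balance fun n _ => (n : ℝ)
    have h2 := hx.balance fun _ b => ((b : ℕ) : ℝ)
    have e : ∀ t : RateChoice A Q S, x t * nextMean γ (fun n _ => (n : ℝ)) t =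
        x t * (((t.1 : ℕ) : ℝ) - ((t.2.2 : ℕ) : ℝ)) +
          x t * nextMean γ (fun _ b => ((b : ℕ) : ℝ)) t := by
      intro t
      by_cases h0 : x t = 0
      · simp [h0]
      · have hf := (hx.feasible t h0).1
        rw [← mul_add]
        congr 1
        have hc := nextMean_const hγ (((t.1 : ℕ) : ℝ) - ((t.2.2 : ℕ) : ℝ)) t
        nth_rewrite 1 [← hc]
        simp only [nextMean, ← Finset.sum_add_distrib, ← mul_add]
        refine Finset.sum_congr rfl fun a' _ => ?_
        push_cast [Nat.cast_sub hf]
        ring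
    simp only [e, Finset.sum_add_distrib, mul_sub, Finset.sum_sub_distrib] at h1
    have h3 : ∑ t, x t * ((t.2.2 : ℕ) : ℝ) < ∑ t, x t * ((t.1 : ℕ) : ℝ) := by
      refine Finset.sum_lt_sum (fun t _ => ?_) ⟨t₀, Finset.mem_univ t₀, ?_⟩
      · by_cases h0 : x t = 0
        · simp [h0]
        · exact mul_le_mul_of_nonneg_left (by exact_mod_cast (hx.feasible t h0).1) (hx.nonneg t)
      · exact mul_lt_mul_of_pos_left (by exact_mod_cast ht₀) hxt₀
    have h4 : ∑ t, x t * (((g t).1 : ℕ) : ℝ) = ∑ t, x t * ((t.2.1 : ℕ) : ℝ) := rfl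
    linarith

/-- A flow with the same mean queue and strictly less power would leave slack in the power budget.
Mixing in a little of a flow with a shorter queue spends it and beats `x`. -/
theorem power_le_of_queue_eq (hγ : γ ∈ Matrix.rowStochastic ℝ (Fin (A + 1)))
    (hAS : A ≤ S) (hAQ : A ≤ Q) (hx : IsOptimalFlow γ P c x) {t₀ : RateChoice A Q S}
    (hxt₀ : 0 < x t₀) (ht₀ : (t₀.2.2 : ℕ) < t₀.1) {y : RateChoice A Q S → ℝ} (hy : IsFlow γ y)
    (hm : ∑ t, y t = 1)
    (hq : ∑ t, y t * ((t.1 : ℕ) : ℝ) = ∑ t, x t * ((t.1 : ℕ) : ℝ)) :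
    ∑ t, x t * P t.2.2 ≤ ∑ t, y t * P t.2.2 := by
  by_contra! hlt
  obtain ⟨w, hw, hwm, hwq⟩ := hx.toIsFlow.exists_queue_lt hγ hAS hAQ hxt₀ ht₀
  set p := ∑ t, x t * P t.2.2
  set py := ∑ t, y t * P t.2.2
  set pw := ∑ t, w t * P t.2.2
  obtain ⟨l, hl0, hl1, hl⟩ : ∃ l : ℝ, 0 < l ∧ l ≤ 1 ∧ (1 - l) * py + l * pw ≤ p := by
    -- The absolute value keeps the denominator positive whichever of `pw`, `py` is larger, and the
    -- mixture then uses at most the slack `p - py`.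
    refine ⟨(p - py) / (p - py + |pw - py|), ?_, ?_, ?_⟩
    · have := abs_nonneg (pw - py)
      exact div_pos (by linarith) (by linarith)
    · have := abs_nonneg (pw - py)
      exact (div_le_one (by linarith)).2 (by linarith)
    · have h0 := abs_nonneg (pw - py)
      have h1 := le_abs_self (pw - py)
      have hd : 0 < p - py + |pw - py| := by linarith
      have : (p - py) / (p - py + |pw - py|) * (pw - py) ≤ p - py := by
        rw [div_mul_eq_mul_div, div_le_iff₀ hd]
        exact mul_le_mul_of_nonneg_left (by linarith) (by linarith)
      linarith
  have hf := hy.add_smul hw (sub_nonneg.2 hl1) hl0.le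
  have hlin : ∀ f : RateChoice A Q S → ℝ, ∑ t, ((1 - l) * y t + l * w t) * f t =
      (1 - l) * ∑ t, y t * f t + l * ∑ t, w t * f t := by
    intro f
    simp only [add_mul, Finset.sum_add_distrib, mul_assoc, ← Finset.mul_sum]
  have h1 : ∑ t, ((1 - l) * y t + l * w t) = 1 := by
    have := hlin fun _ => 1
    simp only [mul_one] at this
    rw [this, hm, hwm, hx.mass]
    ring
  have h2 := hx.queue_le _ hf h1 (by
    rw [hlin fun t => P t.2.2]
    exact hl.trans hx.power_le)
  rw [hlin fun t => ((t.1 : ℕ) : ℝ), hq] at h2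
  nlinarith

end IsOptimalFlow

end Flow

/-! ### Exchange argument and maximal support. -/

section Swap

/-- Increments of `P` over a fixed length grow with the starting point. Both `r₁` and `r₂` lie
between `s₁` and `s₂` with the same sum, so the bound compares the increments from `s₁` to `r₁` and
from `r₂` to `s₂`. -/
theorem add_le_add_of_discrete_convex {S : ℕ} {P : Fin (S + 1) → ℝ}
    (hP : ∀ r s t : Fin (S + 1), (r : ℕ) + 1 = s → (s : ℕ) + 1 = t → 2 * P s ≤ P r + P t)
    {s₁ s₂ r₁ r₂ : Fin (S + 1)} (h₁ : s₁ ≤ r₁) (h₂ : s₁ ≤ r₂)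
    (h : (r₁ : ℕ) + r₂ = s₁ + s₂) : P r₁ + P r₂ ≤ P s₁ + P s₂ := by
  obtain ⟨p, hp⟩ : ∃ p : ℕ → ℝ, ∀ s : Fin (S + 1), P s = p s :=
    ⟨fun n => P ⟨min n S, by omega⟩, fun s => congrArg P (Fin.ext (by dsimp only; omega))⟩
  have hc : ∀ n, n + 2 ≤ S → 2 * p (n + 1) ≤ p n + p (n + 2) := by
    intro n hn
    have := hP ⟨n, by omega⟩ ⟨n + 1, by omega⟩ ⟨n + 2, by omega⟩ rfl rfl
    simpa only [hp] using this
  have hA : ∀ j n, n + j + 1 ≤ S → p (n + 1) - p n ≤ p (n + j + 1) - p (n + j) := by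
    intro j
    induction j with
    | zero => intro n _; exact le_rfl
    | succ j ih =>
      intro n hn
      have h1 := ih n (by omega)
      have h2 := hc (n + j) (by omega)
      have e : n + (j + 1) = n + j + 1 := rfl
      rw [e]
      linarith
  have hB : ∀ i j u, u + i + j ≤ S → p (u + i) - p u ≤ p (u + i + j) - p (u + j) := by
    intro i
    induction i with
    | zero => intro j u _; simp
    | succ i ih =>
      intro j u hu
      have h1 := ih j u (by omega)
      have h2 := hA j (u + i) (by omega)
      have e1 : u + (i + 1) = u + i + 1 := rfl
      have e2 : u + i + 1 + j = u + i + j + 1 := by omega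
      rw [e1, e2]
      linarith
  have h1 : (s₁ : ℕ) ≤ r₁ := h₁
  have h2 : (s₁ : ℕ) ≤ r₂ := h₂
  have := hB (r₁ - s₁) (r₂ - s₁) s₁ (by omega)
  rw [show (s₁ : ℕ) + (r₁ - s₁) = r₁ by omega, show (r₁ : ℕ) + (r₂ - s₁) = s₂ by omega,
    show (s₁ : ℕ) + (r₂ - s₁) = r₂ by omega] at this
  simp only [hp]
  linarith

variable {A Q S : ℕ} {γ : Matrix (Fin (A + 1)) (Fin (A + 1)) ℝ} {P : Fin (S + 1) → ℝ} {c : ℝ}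
  {x : RateChoice A Q S → ℝ}

/-- The support of `x` contains those of all state-action frequencies of the same power and mean
queue length. -/
def HasMaximalSupport (γ : Matrix (Fin (A + 1)) (Fin (A + 1)) ℝ) (P : Fin (S + 1) → ℝ)
    (x : RateChoice A Q S → ℝ) : Prop :=
  ∀ y : RateChoice A Q S → ℝ, IsFlow γ y → ∑ t, y t = 1 →
    ∑ t, y t * P t.2.2 = ∑ t, x t * P t.2.2 →
    ∑ t, y t * ((t.1 : ℕ) : ℝ) = ∑ t, x t * ((t.1 : ℕ) : ℝ) → ∀ t, 0 < y t → 0 < x t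

/-- Exchanging the leftovers of two crossing choices brings the rates closer together. The power
cannot rise by convexity nor fall by optimality, so maximal support applies to the exchanged flow.
-/
theorem IsOptimalFlow.exists_swap (hγ : γ ∈ Matrix.rowStochastic ℝ (Fin (A + 1)))
    (hAS : A ≤ S) (hAQ : A ≤ Q)
    (hP : ∀ r s t : Fin (S + 1), (r : ℕ) + 1 = s → (s : ℕ) + 1 = t → 2 * P s ≤ P r + P t)
    (hx : IsOptimalFlow γ P c x) (hmax : HasMaximalSupport γ P x) {t₁ t₂ : RateChoice A Q S}
    (h₁ : 0 < x t₁) (h₂ : 0 < x t₂) (ha : t₁.2.1 = t₂.2.1) (hq : (t₁.1 : ℕ) < t₂.1)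
    (hr : (t₂.1 : ℕ) - t₂.2.2 < t₁.1 - t₁.2.2) :
    ∃ t : RateChoice A Q S, t.1 = t₁.1 ∧ t.2.1 = t₁.2.1 ∧ 0 < x t ∧
      (t.1 : ℕ) - t.2.2 = t₂.1 - t₂.2.2 := by
  have hf₁ := hx.feasible t₁ h₁.ne'
  have hf₂ := hx.feasible t₂ h₂.ne'
  obtain ⟨q₁, a, s₁⟩ := t₁
  obtain ⟨q₂, a₂, s₂⟩ := t₂
  obtain rfl : a = a₂ := ha
  dsimp only at hq hr hf₁ hf₂ ⊢
  obtain ⟨hf₁, hf₁'⟩ := hf₁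
  obtain ⟨hf₂, hf₂'⟩ := hf₂
  set u₁ : RateChoice A Q S := (q₁, a, ⟨q₁ - (q₂ - s₂), by omega⟩) with hu₁
  set u₂ : RateChoice A Q S := (q₂, a, ⟨q₂ - (q₁ - s₁), by omega⟩) with hu₂
  set t₁ : RateChoice A Q S := (q₁, a, s₁) with ht₁
  set t₂ : RateChoice A Q S := (q₂, a, s₂) with ht₂
  have hne : t₁ ≠ t₂ := fun h => hq.ne (congrArg (fun t : RateChoice A Q S => (t.1 : ℕ)) h)
  have hne1 : u₁ ≠ t₁ := by
    intro h
    have := congrArg (fun t : RateChoice A Q S => (t.2.2 : ℕ)) h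
    simp only [hu₁, ht₁] at this
    omega
  have hne2 : u₁ ≠ t₂ := fun h => hq.ne (congrArg (fun t : RateChoice A Q S => (t.1 : ℕ)) h)
  -- The largest mass that can be moved off both `t₁` and `t₂` without making either negative.
  set ε := min (x t₁) (x t₂) with hε
  have hε0 : 0 < ε := lt_min h₁ h₂
  let e : RateChoice A Q S → RateChoice A Q S → ℝ := fun v t => if t = v then 1 else 0
  have he0 : ∀ v t, 0 ≤ e v t := fun v t => by dsimp only [e]; split_ifs <;> norm_num
  have hes : ∀ v, ∀ f : RateChoice A Q S → ℝ, ∑ t, e v t * f t = f v := fun v f => by simp [e]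
  set y : RateChoice A Q S → ℝ := fun t => x t + ε * (e u₁ t + e u₂ t - e t₁ t - e t₂ t) with hy
  have hlin : ∀ f : RateChoice A Q S → ℝ, ∑ t, y t * f t =
      ∑ t, x t * f t + ε * (f u₁ + f u₂ - f t₁ - f t₂) := by
    intro f
    simp only [hy, add_mul, mul_assoc, sub_mul, Finset.sum_add_distrib, ← Finset.mul_sum,
      Finset.sum_sub_distrib, hes]
  have hsplit : ∀ t, ε * (e t₁ t + e t₂ t) ≤ x t := by
    intro t
    by_cases h1 : t = t₁
    · subst h1
      simp [e, hne, hε]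
    · by_cases h2 : t = t₂
      · subst h2
        simp [e, Ne.symm hne, hε]
      · simpa [e, h1, h2] using hx.nonneg t
  have hyf : IsFlow γ y := by
    refine ⟨fun t => ?_, fun t ht => ?_, fun h => ?_⟩
    · have h1 := hsplit t
      have h2 := mul_nonneg hε0.le (add_nonneg (he0 u₁ t) (he0 u₂ t))
      simp only [hy]
      linarith
    · by_cases hxt : x t = 0
      · by_cases h1 : t = u₁
        · rw [h1]
          exact ⟨by dsimp only [u₁]; omega, by dsimp only [u₁]; omega⟩
        by_cases h2 : t = u₂
        · rw [h2]
          exact ⟨by dsimp only [u₂]; omega, by dsimp only [u₂]; omega⟩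
        refine absurd ?_ ht
        have h3 : t ≠ t₁ := fun h => h₁.ne' (h ▸ hxt)
        have h4 : t ≠ t₂ := fun h => h₂.ne' (h ▸ hxt)
        simp [hy, e, h1, h2, h3, h4, hxt]
      · exact hx.feasible t hxt
    · have e1 : nextMean γ h u₁ = nextMean γ h t₂ := by
        dsimp only [u₁, t₂, nextMean]
        rw [show (q₁ : ℕ) - (q₁ - (q₂ - s₂)) = q₂ - s₂ by omega]
      have e2 : nextMean γ h u₂ = nextMean γ h t₁ := by
        dsimp only [u₂, t₁, nextMean]
        rw [show (q₂ : ℕ) - (q₂ - (q₁ - s₁)) = q₁ - s₁ by omega]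
      rw [hlin, hlin fun t => h t.1 t.2.1, hx.balance, e1, e2]
      simp only [hu₁, hu₂, ht₁, ht₂]
      ring
  have hm : ∑ t, y t = 1 := by
    have := hlin fun _ => 1
    simp only [mul_one] at this
    rw [this, hx.mass]
    ring
  have hyq : ∑ t, y t * ((t.1 : ℕ) : ℝ) = ∑ t, x t * ((t.1 : ℕ) : ℝ) := by
    rw [hlin fun t => ((t.1 : ℕ) : ℝ)]
    simp only [hu₁, hu₂, ht₁, ht₂]
    ring
  have hyp : ∑ t, y t * P t.2.2 ≤ ∑ t, x t * P t.2.2 := by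
    rw [hlin fun t => P t.2.2]
    have := add_le_add_of_discrete_convex hP (s₁ := s₁) (s₂ := s₂) (r₁ := u₁.2.2) (r₂ := u₂.2.2)
      (Fin.le_def.2 (by dsimp only [u₁]; omega)) (Fin.le_def.2 (by dsimp only [u₂]; omega))
      (by dsimp only [u₁, u₂]; omega)
    have : ε * (P u₁.2.2 + P u₂.2.2 - P s₁ - P s₂) ≤ 0 :=
      mul_nonpos_of_nonneg_of_nonpos hε0.le (by linarith)
    simpa only [ht₁, ht₂, add_le_iff_nonpos_right] using this
  -- The choice `t₁` does not empty the buffer, since its leftover exceeds that of `t₂`; this is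
  -- what `power_le_of_queue_eq` requires.
  have hyp' := hyp.antisymm
    (hx.power_le_of_queue_eq hγ hAS hAQ h₁ (by dsimp only [t₁]; omega) hyf hm hyq)
  refine ⟨u₁, rfl, rfl, hmax y hyf hm hyp' hyq u₁ ?_, by dsimp only [u₁]; omega⟩
  have h1 : e t₁ u₁ = 0 := if_neg hne1
  have h2 : e t₂ u₁ = 0 := if_neg hne2
  have h3 : e u₁ u₁ = 1 := if_pos rfl
  have h4 := mul_nonneg hε0.le (he0 u₂ u₁)
  have h5 := hx.nonneg u₁
  simp only [hy, h1, h2, h3]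
  linarith

/-- Two disjoint closed sets of recurrent states do not coexist. -/
theorem IsOptimalFlow.closedUnder_inter (hγ : γ ∈ Matrix.rowStochastic ℝ (Fin (A + 1)))
    (hirr : γ.IsIrreducible) (hAS : A ≤ S) (hAQ : A ≤ Q)
    (hP : ∀ r s t : Fin (S + 1), (r : ℕ) + 1 = s → (s : ℕ) + 1 = t → 2 * P s ≤ P r + P t)
    (hx : IsOptimalFlow γ P c x) (hmax : HasMaximalSupport γ P x)
    {V₁ V₂ : ℕ → Fin (A + 1) → Prop} (hV₁ : ClosedUnder γ x V₁) (hV₂ : ClosedUnder γ x V₂)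
    {t₁ t₂ : RateChoice A Q S} (ht₁ : V₁ t₁.1 t₁.2.1) (ht₂ : V₂ t₂.1 t₂.2.1)
    (h₁ : 0 < x t₁) (h₂ : 0 < x t₂) :
    ∃ t : RateChoice A Q S, V₁ t.1 t.2.1 ∧ V₂ t.1 t.2.1 ∧ 0 < x t := by
  by_contra! H
  obtain ⟨t₁', ht₁', h₁', ha⟩ := hx.exists_pos_of_closedUnder hγ.1 hV₁ ht₁ h₁
    (reflTransGen_of_isIrreducible hirr t₁.2.1 t₂.2.1)
  clear h₁ ht₁
  -- Irreducibility has made the arrivals equal; equal queue lengths would then give a common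
  -- occupied state, and the roles of the two sets are symmetric.
  wlog hq : (t₁'.1 : ℕ) < t₂.1 generalizing V₁ V₂ t₁' t₂
  · refine this hV₂ hV₁ ht₁' h₁' (fun t h2 h1 => H t h1 h2) t₂ ht₂ h₂ ha.symm ?_
    refine lt_of_le_of_ne (not_lt.1 hq) fun h => ?_
    refine (H t₂ ?_ ht₂).not_gt h₂
    rwa [h, ← ha]
  have hdisj : ∀ u v : RateChoice A Q S, V₁ u.1 u.2.1 → V₂ v.1 v.2.1 → 0 < x u → 0 < x v →
      u.2.1 = v.2.1 → (u.1 : ℕ) - u.2.2 ≠ v.1 - v.2.2 := by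
    intro u v hu hv hxu hxv ha h
    obtain ⟨b, hb⟩ := exists_arrival_pos hγ u.2.1
    obtain ⟨w, hw1, hw2, hxw⟩ := hx.occupied_next hγ.1 hxu hb
    refine (H w ?_ ?_).not_gt hxw
    · rw [hw1, hw2]
      exact hV₁ u b hu hxu hb
    · rw [hw1, hw2, h]
      exact hV₂ v b hv hxv (ha ▸ hb)
  -- Crossing would, by `exists_swap`, give a used choice in `V₁` with the leftover of one in `V₂`,
  -- so the two sets would meet after the next arrival.
  have hord : ∀ u v : RateChoice A Q S, V₁ u.1 u.2.1 → V₂ v.1 v.2.1 → 0 < x u → 0 < x v →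
      u.2.1 = v.2.1 → (u.1 : ℕ) < v.1 → (u.1 : ℕ) - u.2.2 < v.1 - v.2.2 := by
    intro u v hu hv hxu hxv ha hlt
    by_contra! hle
    obtain ⟨w, hw1, hw2, hxw, hwr⟩ := hx.exists_swap hγ hAS hAQ hP hmax hxu hxv ha hlt
      (lt_of_le_of_ne hle (hdisj u v hu hv hxu hxv ha).symm)
    exact hdisj w v (by rwa [hw1, hw2]) hv hxw hxv (hw2.trans ha) hwr
  -- The states of `V₂` lying above an occupied state of `V₁` with the same arrivals form a closed
  -- set, yet emptying there would put the lower leftover below zero.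
  obtain ⟨t, ⟨hVt, u, hu, hxu, hua, hut⟩, hxt, hst⟩ := hx.exists_emptying hγ
    (W := fun n b => V₂ n b ∧ ∃ u : RateChoice A Q S, V₁ u.1 u.2.1 ∧ 0 < x u ∧ u.2.1 = b ∧
      (u.1 : ℕ) < n) (t₀ := t₂) (fun t b ⟨hVt, u, hu, hxu, hua, hut⟩ hxt hb => by
        obtain ⟨w, hw1, hw2, hxw⟩ := hx.occupied_next hγ.1 hxu (hua ▸ hb)
        refine ⟨hV₂ t b hVt hxt hb, w, ?_, hxw, hw2, ?_⟩
        · rw [hw1, hw2]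
          exact hV₁ u b hu hxu (hua ▸ hb)
        · have := hord u t hu hVt hxu hxt hua hut
          omega) ⟨ht₂, t₁', ht₁', h₁', ha, hq⟩ h₂
  have := hord u t hu hVt hxu hxt hua hut
  omega

/-- Only finitely many supports occur, and the midpoint of two admissible flows has the union of
their supports. -/
theorem exists_hasMaximalSupport (hx : IsFlow γ x) (hm : ∑ t, x t = 1) :
    ∃ y : RateChoice A Q S → ℝ, IsFlow γ y ∧ ∑ t, y t = 1 ∧
      ∑ t, y t * P t.2.2 = ∑ t, x t * P t.2.2 ∧
      ∑ t, y t * ((t.1 : ℕ) : ℝ) = ∑ t, x t * ((t.1 : ℕ) : ℝ) ∧ HasMaximalSupport γ P y := by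
  classical
  let Z : Set (RateChoice A Q S → ℝ) := {y | IsFlow γ y ∧ ∑ t, y t = 1 ∧
      ∑ t, y t * P t.2.2 = ∑ t, x t * P t.2.2 ∧
      ∑ t, y t * ((t.1 : ℕ) : ℝ) = ∑ t, x t * ((t.1 : ℕ) : ℝ)}
  let supp : (RateChoice A Q S → ℝ) → Finset (RateChoice A Q S) := fun y => {t | 0 < y t}
  obtain ⟨_, hmaxl⟩ := (Set.toFinite (supp '' Z)).exists_maximal ⟨_, x, ⟨hx, hm, rfl, rfl⟩, rfl⟩
  obtain ⟨⟨y, ⟨hy, hym, hyp, hyq⟩, rfl⟩, hmaxl⟩ := hmaxl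
  refine ⟨y, hy, hym, hyp, hyq, fun w hw hwm hwp hwq t ht => ?_⟩
  have hlin : ∀ f : RateChoice A Q S → ℝ, ∑ t, ((1 / 2 : ℝ) * y t + (1 / 2 : ℝ) * w t) * f t =
      (1 / 2) * ∑ t, y t * f t + (1 / 2) * ∑ t, w t * f t := by
    intro f
    simp only [add_mul, Finset.sum_add_distrib, mul_assoc, ← Finset.mul_sum]
  have hmem : (fun t => (1 / 2 : ℝ) * y t + (1 / 2 : ℝ) * w t) ∈ Z := by
    refine ⟨hy.add_smul hw (by norm_num) (by norm_num), ?_, ?_, ?_⟩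
    · have := hlin fun _ => 1
      simp only [mul_one] at this
      rw [this, hym, hwm]
      norm_num
    · rw [hlin fun t => P t.2.2, hwp, hyp]
      ring
    · rw [hlin fun t => ((t.1 : ℕ) : ℝ), hwq, hyq]
      ring
  have hle := hmaxl (Set.mem_image_of_mem supp hmem) (fun t ht => by
    have h1 : 0 < y t := by simpa [supp] using ht
    have h2 := hw.nonneg t
    simp only [supp, Finset.mem_filter_univ]
    linarith)
  have : t ∈ supp y := hle (by
    have h2 := hy.nonneg t
    simp only [supp, Finset.mem_filter_univ]
    linarith)
  simpa [supp] using this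

end Swap

/-! ### Policies, their chains and state-action frequencies. -/

section Policy

variable {A Q S : ℕ} {γ : Matrix (Fin (A + 1)) (Fin (A + 1)) ℝ}

theorem queueStep_nonneg (q s a' q' : ℕ) : 0 ≤ queueStep q s a' q' := by
  rw [queueStep]
  split_ifs <;> norm_num

theorem sum_queueStep_mul {q s : ℕ} (hf : FeasibleRate A Q q s) (a' : Fin (A + 1)) (h : ℕ → ℝ) :
    ∑ q' : Fin (Q + 1), queueStep q s a' q' * h q' = h (q - s + a') := by
  obtain ⟨h1, h2⟩ := hf
  rw [Finset.sum_eq_single (⟨q - s + a', by omega⟩ : Fin (Q + 1))]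
  · rw [queueStep, if_pos (by dsimp only; omega), one_mul]
  · intro q' _ hq'
    rw [queueStep, if_neg, zero_mul]
    intro h
    exact hq' (Fin.ext (by dsimp only; omega))
  · simp

theorem sum_rateChoice (f : RateChoice A Q S → ℝ) :
    ∑ t, f t = ∑ q, ∑ a, ∑ s, f (q, a, s) := by
  rw [Fintype.sum_prod_type]
  exact Finset.sum_congr rfl fun q _ => Fintype.sum_prod_type _

/-- The balance equations are the tests against indicators of single states, and by linearity they
give every test function. -/
theorem mem_stateActionFrequencies_iff {x : Fin (Q + 1) → Fin (A + 1) → Fin (S + 1) → ℝ} :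
    x ∈ stateActionFrequencies A Q S γ ↔
      IsFlow γ (fun t : RateChoice A Q S => x t.1 t.2.1 t.2.2) ∧
        ∑ t : RateChoice A Q S, x t.1 t.2.1 t.2.2 = 1 := by
  constructor
  · rintro ⟨hb, hm, h0, hf⟩
    have hf' : ∀ t : RateChoice A Q S, x t.1 t.2.1 t.2.2 ≠ 0 → FeasibleRate A Q t.1 t.2.2 :=
      fun t ht => by
        by_contra h
        exact ht (hf _ _ _ h)
    refine ⟨⟨fun t => h0 _ _ _, hf', fun h => ?_⟩, by rwa [sum_rateChoice]⟩
    have key : ∑ q' : Fin (Q + 1), ∑ a' : Fin (A + 1), h q' a' *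
        ∑ t : RateChoice A Q S, γ t.2.1 a' * x t.1 t.2.1 t.2.2 * queueStep t.1 t.2.2 a' q' =
        ∑ q' : Fin (Q + 1), ∑ a' : Fin (A + 1), h q' a' * ∑ s, x q' a' s := by
      refine Finset.sum_congr rfl fun q' _ => Finset.sum_congr rfl fun a' _ => ?_
      rw [sum_rateChoice, ← hb q' a']
    have hR : ∑ t : RateChoice A Q S, x t.1 t.2.1 t.2.2 * h t.1 t.2.1 =
        ∑ q' : Fin (Q + 1), ∑ a' : Fin (A + 1), h q' a' * ∑ s, x q' a' s := by
      rw [sum_rateChoice]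
      simp only [Finset.mul_sum, mul_comm]
    rw [hR, ← key]
    simp only [Finset.mul_sum]
    rw [Finset.sum_comm]
    simp only [Finset.sum_comm (s := (Finset.univ : Finset (Fin (Q + 1))))
      (t := (Finset.univ : Finset (RateChoice A Q S)))]
    rw [Finset.sum_comm]
    refine Finset.sum_congr rfl fun t _ => ?_
    rw [nextMean, Finset.mul_sum]
    refine Finset.sum_congr rfl fun a' _ => ?_
    by_cases ht : x t.1 t.2.1 t.2.2 = 0
    · simp [ht]
    · rw [← sum_queueStep_mul (hf' t ht) a' fun n => h n a', Finset.mul_sum, Finset.mul_sum]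
      exact Finset.sum_congr rfl fun q' _ => by ring
  · rintro ⟨hx, hm⟩
    refine ⟨fun q' a' => ?_, by rwa [sum_rateChoice] at hm, fun q a s => hx.nonneg (q, a, s),
      fun q a s h => ?_⟩
    · have h := hx.balance fun n b => if n = q' ∧ b = a' then 1 else 0
      have hR : ∑ t : RateChoice A Q S, x t.1 t.2.1 t.2.2 *
          (if (t.1 : ℕ) = q' ∧ t.2.1 = a' then 1 else 0) = ∑ s, x q' a' s := by
        rw [sum_rateChoice, Finset.sum_eq_single q', Finset.sum_eq_single a']
        · simp
        · intro b _ hb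
          simp [hb]
        · simp
        · intro q _ hq
          have : (q : ℕ) ≠ q' := fun h => hq (Fin.ext h)
          simp [this]
        · simp
      rw [← hR, ← h, sum_rateChoice]
      refine Finset.sum_congr rfl fun q _ => Finset.sum_congr rfl fun a _ =>
        Finset.sum_congr rfl fun s _ => ?_
      dsimp only
      by_cases ht : x q a s = 0
      · simp [ht]
      · obtain ⟨h1, h2⟩ := hx.feasible (q, a, s) ht
        dsimp only at h1 h2
        rw [nextMean, Finset.sum_eq_single a']
        · have : (q : ℕ) - s + a' = q' ↔ (q' : ℕ) + s = q + a' := by omega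
          simp only [queueStep, and_true, this]
          split_ifs <;> ring
        · intro b _ hb
          simp [hb]
        · simp
    · by_contra h'
      exact h (hx.feasible (q, a, s) h')

namespace TransmissionPolicy

variable (F : TransmissionPolicy A Q S)

theorem transition_mem_rowStochastic (hγ : γ ∈ Matrix.rowStochastic ℝ (Fin (A + 1))) :
    F.transition γ ∈ Matrix.rowStochastic ℝ (LinkState A Q) := by
  refine Matrix.mem_rowStochastic_iff_sum.2 ⟨fun x y => mul_nonneg (hγ.1 _ _)
    (Finset.sum_nonneg fun s _ => mul_nonneg (F.nonneg _ _ _) (queueStep_nonneg _ _ _ _)),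
    fun x => ?_⟩
  simp only [TransmissionPolicy.transition]
  rw [Fintype.sum_prod_type, Finset.sum_comm]
  refine Eq.trans (Finset.sum_congr rfl fun a' _ => ?_)
    (Matrix.sum_row_of_mem_rowStochastic hγ x.2)
  dsimp only
  rw [← Finset.mul_sum, Finset.sum_comm]
  suffices h : ∀ s, ∑ q' : Fin (Q + 1), F.prob x.1 x.2 s * queueStep x.1 s a' q' =
      F.prob x.1 x.2 s by
    simp only [h, F.sum_eq_one, mul_one]
  intro s
  by_cases hs : FeasibleRate A Q x.1 s
  · have := sum_queueStep_mul hs a' fun _ => 1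
    simp only [mul_one] at this
    rw [← Finset.mul_sum, this, mul_one]
  · simp [F.eq_zero_of_infeasible _ _ _ hs]

theorem transition_pos {x y : LinkState A Q} {s : Fin (S + 1)}
    (hs : 0 < F.prob x.1 x.2 s) (ha : 0 < γ x.2 y.2) (h : (y.1 : ℕ) + s = x.1 + y.2) :
    0 < F.transition γ x y := by
  refine mul_pos ha (Finset.sum_pos' (fun s _ => mul_nonneg (F.nonneg _ _ _)
    (queueStep_nonneg _ _ _ _)) ⟨s, Finset.mem_univ s, ?_⟩)
  rw [queueStep, if_pos h, mul_one]
  exact hs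

theorem isStationaryLaw_iff {π : LinkState A Q → ℝ} (hπ : ∀ x, 0 ≤ π x) :
    IsStationaryLaw (F.transition γ) π ↔
      (fun q a s => π (q, a) * F.prob q a s) ∈ stateActionFrequencies A Q S γ := by
  have hs : ∀ q a, ∑ s, π (q, a) * F.prob q a s = π (q, a) := fun q a => by
    rw [← Finset.mul_sum, F.sum_eq_one, mul_one]
  have hb : ∀ (q' : Fin (Q + 1)) (a' : Fin (A + 1)), ∑ q : Fin (Q + 1), ∑ a : Fin (A + 1), ∑ s : Fin (S + 1),
      γ a a' * (π (q, a) * F.prob q a s) * queueStep q s a' q' =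
      ∑ x, π x * F.transition γ x (q', a') := by
    intro q' a'
    rw [Fintype.sum_prod_type]
    refine Finset.sum_congr rfl fun q _ => Finset.sum_congr rfl fun a _ => ?_
    simp only [TransmissionPolicy.transition, Finset.mul_sum]
    exact Finset.sum_congr rfl fun s _ => by ring
  simp only [stateActionFrequencies, Set.mem_ofPred_eq, hs, hb]
  constructor
  · rintro ⟨-, h1, h2⟩
    refine ⟨fun q' a' => h2 _, by rwa [Fintype.sum_prod_type] at h1,
      fun q a s => mul_nonneg (hπ _) (F.nonneg _ _ _), fun q a s h => ?_⟩
    rw [F.eq_zero_of_infeasible q a s h, mul_zero]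
  · rintro ⟨h1, h2, -, -⟩
    exact ⟨hπ, by rwa [Fintype.sum_prod_type], fun y => h1 _ _⟩

theorem expectedPower_eq (P : Fin (S + 1) → ℝ) (μ : LinkState A Q → ℝ) :
    F.expectedPower P μ = ∑ q, ∑ a, ∑ s, P s * (μ (q, a) * F.prob q a s) := by
  simp only [TransmissionPolicy.expectedPower, mul_assoc]

theorem expectedQueue_eq (μ : LinkState A Q → ℝ) :
    expectedQueue μ = ∑ q : Fin (Q + 1), ∑ a : Fin (A + 1), ∑ s : Fin (S + 1),
      ((q : ℕ) : ℝ) * (μ (q, a) * F.prob q a s) := by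
  simp only [expectedQueue, ← Finset.mul_sum, F.sum_eq_one, mul_one]

theorem mem_obtainablePairs (P : Fin (S + 1) → ℝ) (α : ℝ) {π : LinkState A Q → ℝ}
    (hπ : IsStationaryLaw (F.transition γ) π) :
    (F.expectedPower P π, (1 / α) * expectedQueue π) ∈ obtainablePairs Q γ α P :=
  ⟨_, (F.isStationaryLaw_iff hπ.1).1 hπ, F.expectedPower_eq P π,
    congrArg ((1 / α) * ·) (F.expectedQueue_eq π)⟩

theorem expectedPower_cesaroLaw (P : Fin (S + 1) → ℝ) (x₀ : LinkState A Q) (N : ℕ) :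
    (1 / (N : ℝ)) * ∑ n ∈ Finset.Icc 1 N, F.expectedPower P (F.stateLaw γ x₀ n) =
      F.expectedPower P (cesaroLaw (F.transition γ) x₀ N) := by
  simp only [TransmissionPolicy.expectedPower, cesaroLaw, TransmissionPolicy.stateLaw]
  rw [Finset.sum_comm, Finset.mul_sum]
  refine Finset.sum_congr rfl fun q _ => ?_
  rw [Finset.sum_comm, Finset.mul_sum]
  refine Finset.sum_congr rfl fun a _ => ?_
  rw [Finset.sum_comm, Finset.mul_sum]
  refine Finset.sum_congr rfl fun s _ => ?_
  rw [← Finset.sum_mul, ← Finset.mul_sum]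
  ring

theorem expectedQueue_cesaroLaw (α : ℝ) (x₀ : LinkState A Q) (N : ℕ) :
    (1 / (N : ℝ)) * ((1 / α) * ∑ n ∈ Finset.Icc 1 N, expectedQueue (F.stateLaw γ x₀ n)) =
      (1 / α) * expectedQueue (cesaroLaw (F.transition γ) x₀ N) := by
  rw [mul_left_comm]
  congr 1
  simp only [expectedQueue, cesaroLaw, TransmissionPolicy.stateLaw]
  rw [Finset.sum_comm, Finset.mul_sum]
  refine Finset.sum_congr rfl fun q _ => ?_
  rw [Finset.sum_comm, Finset.mul_sum]
  refine Finset.sum_congr rfl fun a _ => ?_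
  rw [← Finset.mul_sum]
  ring

theorem attainsFrom_iff (α : ℝ) (P : Fin (S + 1) → ℝ) (x₀ : LinkState A Q) (z : ℝ × ℝ) :
    F.AttainsFrom γ α P x₀ z ↔
      Tendsto (fun N => F.expectedPower P (cesaroLaw (F.transition γ) x₀ N)) atTop (𝓝 z.1) ∧
      Tendsto (fun N => (1 / α) * expectedQueue (cesaroLaw (F.transition γ) x₀ N))
        atTop (𝓝 z.2) := by
  simp only [TransmissionPolicy.AttainsFrom, expectedPower_cesaroLaw, expectedQueue_cesaroLaw]

theorem continuous_expectedPower (P : Fin (S + 1) → ℝ) : Continuous (F.expectedPower P) := by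
  unfold TransmissionPolicy.expectedPower
  fun_prop

theorem continuous_expectedQueue : Continuous (expectedQueue (A := A) (Q := Q)) := by
  unfold expectedQueue
  fun_prop

end TransmissionPolicy

/-- Time-averaged laws have a stationary limit point, at which power and delay, being continuous,
take the limiting values. -/
theorem pairsFrom_subset_obtainablePairs (hγ : γ ∈ Matrix.rowStochastic ℝ (Fin (A + 1))) (α : ℝ)
    (P : Fin (S + 1) → ℝ) (x₀ : LinkState A Q) :
    pairsFrom γ α P x₀ ⊆ obtainablePairs Q γ α P := by
  rintro z ⟨F, hF⟩
  rw [F.attainsFrom_iff] at hF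
  obtain ⟨μ, hμ, j, hj, hlim⟩ := exists_subseq_tendsto_stationary
    (F.transition_mem_rowStochastic hγ) x₀ tendsto_id
  have h1 := tendsto_nhds_unique (hF.1.comp hj.tendsto_atTop)
    (((F.continuous_expectedPower P).tendsto μ).comp hlim)
  have h2 := tendsto_nhds_unique (hF.2.comp hj.tendsto_atTop)
    (((TransmissionPolicy.continuous_expectedQueue.tendsto μ).const_mul (1 / α)).comp hlim)
  have : z = (F.expectedPower P μ, (1 / α) * expectedQueue μ) := Prod.ext h1 h2
  exact this ▸ F.mem_obtainablePairs P α hμ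

/-- The policy with state-action frequencies `x`; the rate is as large as possible in the states
not visited by `x`. -/
noncomputable def flowPolicy (hAS : A ≤ S) (hAQ : A ≤ Q) {x : RateChoice A Q S → ℝ}
    (hx : IsFlow γ x) : TransmissionPolicy A Q S where
  prob q a s := if ∑ r, x (q, a, r) = 0 then (if (s : ℕ) = min (q : ℕ) S then 1 else 0)
    else x (q, a, s) / ∑ r, x (q, a, r)
  nonneg q a s := by
    split_ifs
    · exact zero_le_one
    · exact le_rfl
    · exact div_nonneg (hx.nonneg _) (Finset.sum_nonneg fun r _ => hx.nonneg _)
  sum_eq_one q a := by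
    by_cases h : ∑ r, x (q, a, r) = 0
    · simp only [h, if_true]
      rw [Finset.sum_eq_single (⟨min (q : ℕ) S, by omega⟩ : Fin (S + 1))]
      · simp
      · intro s _ hs
        exact if_neg fun h => hs (Fin.ext h)
      · simp
    · simp only [h, if_false]
      rw [← Finset.sum_div, div_self h]
  eq_zero_of_infeasible q a s hs := by
    by_cases h : ∑ r, x (q, a, r) = 0
    · rw [if_pos h, if_neg]
      intro h'
      -- `min q S` never overflows: `A ≤ Q` covers an emptied buffer, and `A ≤ S` a transmission at
      -- full rate.
      exact hs ⟨by omega, by omega⟩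
    · rw [if_neg h, div_eq_zero_iff]
      left
      by_contra h'
      exact hs (hx.feasible _ h')

/-! ### The policy built from a flow, and its unichain property. -/

section FlowPolicy

variable (hAS : A ≤ S) (hAQ : A ≤ Q) {x : RateChoice A Q S → ℝ} (hx : IsFlow γ x)

theorem mul_flowPolicy_prob (q : Fin (Q + 1)) (a : Fin (A + 1)) (s : Fin (S + 1)) :
    (∑ r, x (q, a, r)) * (flowPolicy hAS hAQ hx).prob q a s = x (q, a, s) := by
  by_cases h : ∑ r, x (q, a, r) = 0
  · rw [h, zero_mul]
    exact ((Finset.sum_eq_zero_iff_of_nonneg fun r _ => hx.nonneg _).1 h s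
      (Finset.mem_univ s)).symm
  · rw [flowPolicy]
    dsimp only
    rw [if_neg h, mul_div_cancel₀ _ h]

theorem flowPolicy_prob_pos {t : RateChoice A Q S} (ht : 0 < x t) :
    0 < (flowPolicy hAS hAQ hx).prob t.1 t.2.1 t.2.2 := by
  refine lt_of_le_of_ne ((flowPolicy hAS hAQ hx).nonneg _ _ _) fun h => ht.ne' ?_
  rw [← mul_flowPolicy_prob hAS hAQ hx t.1 t.2.1 t.2.2, ← h, mul_zero]

theorem flowPolicy_prob_min_pos {q : Fin (Q + 1)} {a : Fin (A + 1)}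
    (h : ∀ s, ¬ 0 < x (q, a, s)) :
    0 < (flowPolicy hAS hAQ hx).prob q a ⟨min (q : ℕ) S, by omega⟩ := by
  have h0 : ∑ r, x (q, a, r) = 0 :=
    Finset.sum_eq_zero fun r _ => le_antisymm (not_lt.1 (h r)) (hx.nonneg _)
  simp [flowPolicy, h0]

theorem isStationaryLaw_flowPolicy (hm : ∑ t, x t = 1) :
    IsStationaryLaw ((flowPolicy hAS hAQ hx).transition γ) fun u => ∑ r, x (u.1, u.2, r) := by
  rw [TransmissionPolicy.isStationaryLaw_iff _ fun u => Finset.sum_nonneg fun r _ => hx.nonneg _]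
  simp only [mul_flowPolicy_prob]
  exact mem_stateActionFrequencies_iff.2 ⟨hx, hm⟩

/-- One state can be reached from every other one. -/
theorem IsOptimalFlow.exists_reachable_state (hA : 0 < A)
    (hγ : γ ∈ Matrix.rowStochastic ℝ (Fin (A + 1))) (hirr : γ.IsIrreducible)
    {P : Fin (S + 1) → ℝ} {c : ℝ}
    (hP : ∀ r s t : Fin (S + 1), (r : ℕ) + 1 = s → (s : ℕ) + 1 = t → 2 * P s ≤ P r + P t)
    (ho : IsOptimalFlow γ P c x) (hmax : HasMaximalSupport γ P x) :
    ∃ v, ∀ u, ∃ n : ℕ, 0 < ((flowPolicy hAS hAQ hx).transition γ ^ n) u v := by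
  set F := flowPolicy hAS hAQ hx
  have hM := F.transition_mem_rowStochastic hγ
  simp only [Matrix.exists_pow_pos_iff_reflTransGen hM.1]
  set R := Relation.ReflTransGen fun u v => 0 < F.transition γ u v with hR
  have hclosed : ∀ u, ClosedUnder γ x fun n b => ∃ v, R u v ∧ (v.1 : ℕ) = n ∧ v.2 = b := by
    rintro u t b ⟨⟨q, a⟩, hv, hv1, hv2⟩ hxt hb
    obtain rfl : q = t.1 := Fin.ext hv1
    obtain rfl : a = t.2.1 := hv2
    obtain ⟨h1, h2⟩ := hx.feasible t hxt.ne'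
    refine ⟨(⟨t.1 - t.2.2 + b, by omega⟩, b), hv.tail ?_, rfl, rfl⟩
    exact F.transition_pos (s := t.2.2) (flowPolicy_prob_pos hAS hAQ hx hxt) hb
      (by dsimp only; omega)
  obtain ⟨t₀, hxt₀⟩ : ∃ t, 0 < x t := by
    by_contra! h
    have := Finset.sum_nonpos fun t (_ : t ∈ Finset.univ) => h t
    rw [ho.mass] at this
    norm_num at this
  -- After an emptying choice and then `b` arrivals, the state `(b, b)` is occupied; it is the
  -- target for paths starting outside the support.
  obtain ⟨t, -, hxt, hts⟩ := ho.exists_emptying hγ (W := fun _ _ => True)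
    (fun _ _ _ _ _ => trivial) trivial hxt₀
  obtain ⟨b, hb⟩ := exists_arrival_pos hγ t.2.1
  obtain ⟨w, hw1, hw2, hxw⟩ := hx.occupied_next hγ.1 hxt hb
  rw [hts, Nat.sub_self, zero_add] at hw1
  have hocc : ∀ u, ∃ v : RateChoice A Q S, 0 < x v ∧ R u (v.1, v.2.1) := by
    intro u
    by_contra! H
    have hstep : ∀ v, R u v → ∀ d, 0 < γ v.2 d →
        ∃ y : LinkState A Q, R u y ∧ (y.1 : ℕ) = v.1 - S + d ∧ y.2 = d := by
      intro v hv d hd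
      refine ⟨(⟨v.1 - S + d, by omega⟩, d), hv.tail ?_, rfl, rfl⟩
      exact F.transition_pos (flowPolicy_prob_min_pos hAS hAQ hx
        fun s hs => H (v.1, v.2, s) hs hv) hd (by dsimp only; omega)
    -- While the support is avoided the policy sends `min q S`, and `A ≤ S` keeps the leftover `q -
    -- S` from growing. From a state with minimal leftover it therefore stays constant along every
    -- arrival path.
    obtain ⟨v, hv, hmin⟩ := Set.exists_min_image {v | R u v} (fun v => (v.1 : ℕ) - S)
      (Set.toFinite _) ⟨u, Relation.ReflTransGen.refl⟩
    have hpath : ∀ d, Relation.TransGen (fun a b => 0 < γ a b) v.2 d →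
        ∃ y : LinkState A Q, R u y ∧ (y.1 : ℕ) = v.1 - S + d ∧ y.2 = d := by
      intro d hd
      induction hd with
      | single h => exact hstep v hv _ h
      | @tail e d _ h ih =>
        obtain ⟨y, hy, hy1, rfl⟩ := ih
        obtain ⟨y', hy', hy1', hy2'⟩ := hstep y hy d h
        have h1 := hmin y hy
        refine ⟨y', hy', ?_, hy2'⟩
        omega
    have htrans : ∀ d, Relation.TransGen (fun a b => 0 < γ a b) v.2 d := by
      intro d
      obtain ⟨e, he⟩ := exists_arrival_pos hγ v.2
      exact Relation.TransGen.head' he (reflTransGen_of_isIrreducible hirr e d)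
    -- A timeslot without arrivals would lower a positive leftover, as `S > 0`. So the minimum is
    -- zero, and an arrival of `b` packets then leads to `(b, b)`.
    obtain ⟨y, hy, hy1, -⟩ := hpath 0 (htrans 0)
    have h1 := hmin y hy
    rw [Fin.val_zero] at hy1
    obtain ⟨y', hy', hy1', hy2'⟩ := hpath b (htrans b)
    refine H w hxw ?_
    have : y' = (w.1, w.2.1) := Prod.ext (Fin.ext (by dsimp only; omega)) (by rw [hy2', hw2])
    exact this ▸ hy'
  -- Any two states reach a common one, because their occupied successors generate closed sets that
  -- meet; finiteness then gives one state for all.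
  have hdir : Directed R (id : LinkState A Q → LinkState A Q) := by
    intro u v
    obtain ⟨u', hu', huu'⟩ := hocc u
    obtain ⟨v', hv', hvv'⟩ := hocc v
    obtain ⟨t, ⟨y, hy, hy1, hy2⟩, ⟨y', hy', hy1', hy2'⟩, -⟩ :=
      ho.closedUnder_inter hγ hirr hAS hAQ hP hmax (hclosed (u'.1, u'.2.1))
        (hclosed (v'.1, v'.2.1)) ⟨_, .refl, rfl, rfl⟩ ⟨_, .refl, rfl, rfl⟩ hu' hv'
    obtain rfl : y = y' := Prod.ext (Fin.ext (hy1.trans hy1'.symm)) (hy2.trans hy2'.symm)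
    exact ⟨y, huu'.trans hy, hvv'.trans hy'⟩
  obtain ⟨v, hv⟩ := hdir.finite_le id
  exact ⟨v, hv⟩

end FlowPolicy

/-! ### Existence of optimal points and conclusion. -/

theorem isCompact_stateActionFrequencies : IsCompact (stateActionFrequencies A Q S γ) := by
  refine (isCompact_Icc (a := (0 : Fin (Q + 1) → Fin (A + 1) → Fin (S + 1) → ℝ))
    (b := 1)).of_isClosed_subset ?_ fun x hx => ⟨fun q a s => hx.2.2.1 q a s, fun q a s => ?_⟩
  · simp only [stateActionFrequencies, Set.ofPred_and, Set.ofPred_forall]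
    refine IsClosed.inter ?_ (IsClosed.inter ?_ (IsClosed.inter ?_ ?_))
    · exact isClosed_iInter fun q => isClosed_iInter fun a =>
        isClosed_eq (by fun_prop) (by fun_prop)
    · exact isClosed_eq (by fun_prop) (by fun_prop)
    · exact isClosed_iInter fun q => isClosed_iInter fun a => isClosed_iInter fun s =>
        isClosed_le (by fun_prop) (by fun_prop)
    · exact isClosed_iInter fun q => isClosed_iInter fun a => isClosed_iInter fun s =>
        isClosed_iInter fun _ => isClosed_eq (by fun_prop) (by fun_prop)
  · obtain ⟨hf, hm⟩ := mem_stateActionFrequencies_iff.1 hx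
    have := Finset.single_le_sum (fun t _ => hf.nonneg t) (Finset.mem_univ (q, a, s))
    rw [hm] at this
    exact this

/-- The obtainable pairs form a compact set, so the least delay under a satisfiable power bound is
attained. -/
theorem exists_tradeoffCurve_le (α : ℝ) (P : Fin (S + 1) → ℝ) {z : ℝ × ℝ} {c : ℝ}
    (hz : z ∈ obtainablePairs Q γ α P) (hc : z.1 ≤ c) :
    ∃ w ∈ tradeoffCurve (obtainablePairs Q γ α P), w.1 ≤ c ∧
      ∀ y ∈ obtainablePairs Q γ α P, y.1 ≤ c → w.2 ≤ y.2 := by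
  have hK : IsCompact (obtainablePairs Q γ α P) := by
    have h := (isCompact_stateActionFrequencies (A := A) (Q := Q) (S := S) (γ := γ)).image
      (f := fun x => (∑ q, ∑ a, ∑ s, P s * x q a s, (1 / α) * ∑ q : Fin (Q + 1),
        ∑ a : Fin (A + 1), ∑ s : Fin (S + 1), ((q : ℕ) : ℝ) * x q a s)) (by fun_prop)
    convert h using 1
    ext w
    exact ⟨fun ⟨x, hx, h1, h2⟩ => ⟨x, hx, Prod.ext h1.symm h2.symm⟩,
      fun ⟨x, hx, h⟩ => ⟨x, hx, (congrArg Prod.fst h).symm, (congrArg Prod.snd h).symm⟩⟩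
  obtain ⟨w, ⟨hw, hwc⟩, hmin⟩ := (hK.inter_right (isClosed_le continuous_fst
    (continuous_const (y := c)))).exists_isMinOn ⟨z, hz, hc⟩ continuous_snd.continuousOn
  have hmin' : ∀ y ∈ obtainablePairs Q γ α P, y.1 ≤ c → w.2 ≤ y.2 :=
    fun y hy hyc => isMinOn_iff.1 hmin y ⟨hy, hyc⟩
  exact ⟨w, ⟨hw, c, hwc, hmin'⟩, hwc, hmin'⟩

theorem meanArrival_pos (hA : 0 < A) (hirr : γ.IsIrreducible) {φ : Fin (A + 1) → ℝ}
    (hφ : IsStationaryLaw γ φ) : 0 < meanArrival φ := by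
  refine Finset.sum_pos' (fun a _ => mul_nonneg (Nat.cast_nonneg _) (hφ.1 a))
    ⟨Fin.last A, Finset.mem_univ _, mul_pos ?_ (hφ.pos_of_isIrreducible hirr _)⟩
  rw [Fin.val_last]
  exact_mod_cast hA

theorem exists_unichain_policy (hA : 0 < A) (hAS : A ≤ S) (hAQ : A ≤ Q)
    (hγ : γ ∈ Matrix.rowStochastic ℝ (Fin (A + 1))) (hirr : γ.IsIrreducible)
    {α : ℝ} (hα : 0 < α) {P : Fin (S + 1) → ℝ}
    (hP : ∀ r s t : Fin (S + 1), (r : ℕ) + 1 = s → (s : ℕ) + 1 = t → 2 * P s ≤ P r + P t)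
    {z : ℝ × ℝ} (hz : z ∈ tradeoffCurve (obtainablePairs Q γ α P)) :
    ∃ F : TransmissionPolicy A Q S, F.IsUnichain γ ∧
      (∃ π : LinkState A Q → ℝ, IsStationaryLaw (F.transition γ) π ∧
        F.expectedPower P π = z.1 ∧ (1 / α) * expectedQueue π = z.2) ∧
      ∀ x₀ : LinkState A Q, F.AttainsFrom γ α P x₀ z := by
  obtain ⟨⟨x₁, hx₁, hz1, hz2⟩, c, hzc, hopt⟩ := hz
  obtain ⟨hf₁, hm₁⟩ := mem_stateActionFrequencies_iff.1 hx₁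
  obtain ⟨x, hx, hm, hxp, hxq, hmax⟩ := exists_hasMaximalSupport (P := P) hf₁ hm₁
  have hpow : ∀ y : RateChoice A Q S → ℝ,
      ∑ t, y t * P t.2.2 = ∑ q, ∑ a, ∑ s, P s * y (q, a, s) := fun y => by
    rw [sum_rateChoice]
    simp only [mul_comm]
  have hque : ∀ y : RateChoice A Q S → ℝ, ∑ t, y t * ((t.1 : ℕ) : ℝ) =
      ∑ q : Fin (Q + 1), ∑ a, ∑ s, ((q : ℕ) : ℝ) * y (q, a, s) := fun y => by
    rw [sum_rateChoice]
    simp only [mul_comm]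
  have hz1' : ∑ t, x t * P t.2.2 = z.1 := by rw [hxp, hpow, hz1]
  have hz2' : (1 / α) * ∑ t, x t * ((t.1 : ℕ) : ℝ) = z.2 := by rw [hxq, hque, hz2]
  -- Passing to maximal support preserved power and mean queue, hence optimality.
  have ho : IsOptimalFlow γ P c x := by
    refine ⟨hx, hm, hz1'.trans_le hzc, fun y hy hym hyp => ?_⟩
    have h := hopt (∑ t, y t * P t.2.2, (1 / α) * ∑ t, y t * ((t.1 : ℕ) : ℝ))
      ⟨fun q a s => y (q, a, s), mem_stateActionFrequencies_iff.2 ⟨hy, hym⟩, hpow y,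
        congrArg ((1 / α) * ·) (hque y)⟩ hyp
    rw [← hz2'] at h
    exact le_of_mul_le_mul_left h (one_div_pos.2 hα)
  set F := flowPolicy hAS hAQ hx with hF
  obtain ⟨v, hv⟩ := ho.exists_reachable_state hAS hAQ hx hA hγ hirr hP hmax
  have hM := F.transition_mem_rowStochastic hγ
  have hπ := isStationaryLaw_flowPolicy hAS hAQ hx hm
  have hFp : F.expectedPower P (fun u => ∑ r, x (u.1, u.2, r)) = z.1 := by
    rw [F.expectedPower_eq, ← hz1', hpow]
    simp only [hF, mul_flowPolicy_prob]
  have hFq : (1 / α) * expectedQueue (fun u : LinkState A Q => ∑ r, x (u.1, u.2, r)) = z.2 := by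
    rw [F.expectedQueue_eq, ← hz2', hque]
    simp only [hF, mul_flowPolicy_prob]
  refine ⟨F, existsUnique_isClosedClass hM.1 v hv, ⟨_, hπ, hFp, hFq⟩, fun x₀ => ?_⟩
  have hlim := tendsto_cesaroLaw hM v hv hπ x₀
  rw [F.attainsFrom_iff, ← hFp, ← hFq]
  exact ⟨((F.continuous_expectedPower P).tendsto _).comp hlim,
    ((TransmissionPolicy.continuous_expectedQueue.tendsto _).const_mul (1 / α)).comp hlim⟩

end Policy

theorem theorem4 (A Q S : ℕ) (hA : 0 < A) (hAS : A ≤ S) (hAQ : A ≤ Q)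
    (γ : Matrix (Fin (A + 1)) (Fin (A + 1)) ℝ)
    (hγ : γ ∈ Matrix.rowStochastic ℝ (Fin (A + 1))) (hγ_irr : γ.IsIrreducible)
    (φ : Fin (A + 1) → ℝ) (hφ : IsStationaryLaw γ φ)
    (P : Fin (S + 1) → ℝ) (hP_zero : P 0 = 0) (hP_mono : Monotone P)
    (hP_convex : ∀ r s t : Fin (S + 1), (r : ℕ) + 1 = s → (s : ℕ) + 1 = t →
      2 * P s ≤ P r + P t) :
    (∀ z ∈ tradeoffCurve (obtainablePairs Q γ (meanArrival φ) P),
      ∃ F : TransmissionPolicy A Q S, F.IsUnichain γ ∧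
        (∃ π : LinkState A Q → ℝ, IsStationaryLaw (F.transition γ) π ∧
          F.expectedPower P π = z.1 ∧ (1 / meanArrival φ) * expectedQueue π = z.2) ∧
        ∀ x₀ : LinkState A Q, F.AttainsFrom γ (meanArrival φ) P x₀ z) ∧
    ∀ x₀ : LinkState A Q,
      tradeoffCurve (pairsFrom γ (meanArrival φ) P x₀) =
        tradeoffCurve (obtainablePairs Q γ (meanArrival φ) P) := by
  have key := fun z => exists_unichain_policy (z := z) hA hAS hAQ hγ hγ_irr
    (meanArrival_pos hA hγ_irr hφ) hP_convex
  refine ⟨key, fun x₀ => Set.Subset.antisymm ?_ ?_⟩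
  · rintro z ⟨hz, c, hzc, hmin⟩
    have hz' := pairsFrom_subset_obtainablePairs hγ _ P x₀ hz
    -- A delay minimal among the pairs attained from `x₀` is compared with the global minimizer `w`
    -- for the same bound, itself attained from `x₀`.
    obtain ⟨w, hw, hwc, hwmin⟩ := exists_tradeoffCurve_le _ P hz' hzc
    obtain ⟨F, -, -, hF⟩ := key w hw
    exact ⟨hz', c, hzc, fun y hy hyc => (hmin w ⟨F, hF x₀⟩ hwc).trans (hwmin y hy hyc)⟩
  · rintro z ⟨hz, c, hzc, hmin⟩
    obtain ⟨F, -, -, hF⟩ := key z ⟨hz, c, hzc, hmin⟩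
    exact ⟨⟨F, hF x₀⟩, c, hzc, fun y hy hyc =>
      hmin y (pairsFrom_subset_obtainablePairs hγ _ P x₀ hy) hyc⟩
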